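/- Let $q\ge 5$ be a prime power and let $P$ be a closed point of degree $3$ of $\mathbf{P}^2$ over $\mathbf{F}_q$ (that is, a Frobenius orbit $\{p,p^{\varphi},p^{\varphi^2}\}$ of three distinct geometric points) which is not contained in any $\mathbf{F}_q$-rational line. Let $\Gamma_5$ be the linear system of plane quintics containing $P$; its $\mathbf{F}_q$-rational elements are the curves $f=0$ with $f\in\mathbf{F}_q[x,y,z]$ a nonzero form of degree $5$ vanishing at the points of $P$. 1. Every $\mathbf{F}_q$-rational element $C$ of $\Gamma_5$ satisfies $\sharp C(\mathbf{F}_q)\le 4q+2$. 2. For every such $q$ and $P$ this bound is attained by some $\mathbf{F}_q$-rational element of $\Gamma_5$. 3. If $C_1$ is an $\mathbf{F}_q$-irreducible conic containing $P$, and $C_2$ is a union of three distinct concurrent $\mathbf{F}_q$-rational lines, none of which meets $C_1$ at a rational point, then $C=C_1\cup C_2$ is an $\mathbf{F}_q$-rational element of $\Gamma_5$ with $\sharp C(\mathbf{F}_q)=4q+2$. For $q\ge 7$ and every $P$, such $C_1$ and $C_2$ exist. 4. For $q=5$, the equations $x^2+xz+yz=0$, $xy+yz+z^2=0$, $4xz+y^2=0$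 define a closed point $P$ of degree $3$ not contained in any $\mathbf{F}_5$-rational line. The quartic form $$ \begin{aligned} Q={}&x^4+2x^3y+3x^3z+3x^2y^2+4x^2yz+3x^2z^2+2xy^3+4xy^2z+xyz^2+3xz^3\\ &+2y^4+4y^3z+2y^2z^2+4yz^3+2z^4 \end{aligned} $$ is irreducible over $\mathbf{F}_5$ and vanishes at $P$. The quintic $xQ=0$ is an element of $\Gamma_5$ with exactly $22=4\cdot 5+2$ rational points over $\mathbf{F}_5$. -/

import Mathlib

open scoped LinearAlgebra.Projectivization

noncomputable section

namespace PlaneQuintics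

/-- The set of `K`-rational points of the projective plane. -/
abbrev PP (K : Type*) [Field K] : Type _ := ℙ K (Fin 3 → K)

/-- The set of geometric points of the projective plane over `F`. -/
abbrev GeomPP (F : Type*) [Field F] : Type _ := PP (AlgebraicClosure F)

/-- `f` is an equation over `F` of a plane curve (effective divisor) of degree `d`:
a nonzero form of degree `d` in the coordinates `x = X 0`, `y = X 1`, `z = X 2`. -/
def IsCurve {F : Type*} [Field F] (d : ℕ) (f : MvPolynomial (Fin 3) F) : Prop :=
  f ≠ 0 ∧ f.IsHomogeneous d

/-- The form `f` over `F` vanishes at the point `p` with coordinates in the extension `K`.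
For forms this does not depend on the choice of homogeneous coordinates
(`vanishesAt_mk_iff`). -/
def VanishesAt {F K : Type*} [Field F] [Field K] [Algebra F K]
    (f : MvPolynomial (Fin 3) F) (p : PP K) : Prop :=
  MvPolynomial.aeval p.rep f = 0

/-- Homogeneity of evaluation. -/
theorem aeval_smul_of_isHomogeneous {F K : Type*} [Field F] [Field K] [Algebra F K]
    {d : ℕ} {f : MvPolynomial (Fin 3) F} (hf : f.IsHomogeneous d) (a : K) (v : Fin 3 → K) :
    MvPolynomial.aeval (a • v) f = a ^ d * MvPolynomial.aeval v f := by
  simp only [MvPolynomial.aeval_def, MvPolynomial.eval₂_eq, Finset.mul_sum]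
  refine Finset.sum_congr rfl fun m hm => ?_
  have hd : ∑ i ∈ m.support, m i = d := by
    have h := hf (MvPolynomial.mem_support_iff.1 hm)
    simpa [Finsupp.weight_apply, Finsupp.sum] using h
  simp only [Pi.smul_apply, smul_eq_mul, mul_pow, Finset.prod_mul_distrib,
    Finset.prod_pow_eq_pow_sum, hd]
  ring

/-- Vanishing of a form may be tested on any homogeneous coordinates of the point. -/
theorem vanishesAt_mk_iff {F K : Type*} [Field F] [Field K] [Algebra F K]
    {d : ℕ} {f : MvPolynomial (Fin 3) F} (hf : f.IsHomogeneous d)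
    (v : Fin 3 → K) (hv : v ≠ 0) :
    VanishesAt f (Projectivization.mk K v hv) ↔ MvPolynomial.aeval v f = 0 := by
  obtain ⟨a, ha⟩ := Projectivization.exists_smul_eq_mk_rep K v hv
  unfold VanishesAt
  rw [← ha, Units.smul_def, aeval_smul_of_isHomogeneous hf]
  simp

/-- The number of `F`-rational points of the curve `f = 0`. -/
def numPoints {F : Type*} [Field F] (f : MvPolynomial (Fin 3) F) : ℕ :=
  Set.ncard {p : PP F | VanishesAt f p}

/-- The coordinatewise `q`-power Frobenius on `K³`, where `q` is the cardinality of `F` and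
`K` is the algebraic closure of `F`. -/
def frobeniusVec (F : Type*) [Field F] [Fintype F] :
    (Fin 3 → AlgebraicClosure F) →ₛₗ[(FiniteField.frobeniusAlgHom F
      (AlgebraicClosure F)).toRingHom] (Fin 3 → AlgebraicClosure F) where
  toFun v i := FiniteField.frobeniusAlgHom F (AlgebraicClosure F) (v i)
  map_add' v w := by ext i; exact map_add _ _ _
  map_smul' a v := by ext i; exact map_mul _ _ _

theorem frobeniusVec_apply (F : Type*) [Field F] [Fintype F]
    (v : Fin 3 → AlgebraicClosure F) (i : Fin 3) :
    frobeniusVec F v i = v i ^ Fintype.card F := rfl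

theorem frobeniusVec_injective (F : Type*) [Field F] [Fintype F] :
    Function.Injective (frobeniusVec F) := fun v w h => by
  ext i
  exact (FiniteField.frobeniusAlgHom F (AlgebraicClosure F)).toRingHom.injective (congrFun h i)

/-- The Frobenius map `(x : y : z) ↦ (x ^ q : y ^ q : z ^ q)` on geometric points. -/
def frobenius (F : Type*) [Field F] [Fintype F] : GeomPP F → GeomPP F :=
  Projectivization.map (frobeniusVec F) (frobeniusVec_injective F)

/-- `P` is a closed point of degree `d` of the projective plane over the finite field `F`,
given by the geometric points it splits into: a Frobenius orbit with exactly `d` elements. -/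
def IsClosedPoint {F : Type*} [Field F] [Fintype F] (d : ℕ) (P : Set (GeomPP F)) : Prop :=
  (∃ p : GeomPP F, P = Set.range fun n : ℕ => (frobenius F)^[n] p) ∧ P.ncard = d

/-- The curve `f = 0` contains `P`. -/
def Contains {F : Type*} [Field F] (f : MvPolynomial (Fin 3) F) (P : Set (GeomPP F)) : Prop :=
  ∀ p ∈ P, VanishesAt f p

/-- `P` is a closed point of degree 3 that is not contained in any `F`-rational line. -/
def IsNoncollinearCubicPoint {F : Type*} [Field F] [Fintype F] (P : Set (GeomPP F)) : Prop :=
  IsClosedPoint 3 P ∧ ∀ l : MvPolynomial (Fin 3) F, IsCurve 1 l → ¬ Contains l P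

/-- (Equations of) the `F`-rational elements of the linear system of plane curves of degree `d`
containing `P`. -/
def Gamma {F : Type*} [Field F] (d : ℕ) (P : Set (GeomPP F)) : Set (MvPolynomial (Fin 3) F) :=
  {f | IsCurve d f ∧ Contains f P}

/-- `c = 0` is an `F`-irreducible conic containing `P`, and `l 0`, `l 1`, `l 2` are (equations of)
three distinct `F`-rational lines through a common rational point, none of which meets the conic
at a rational point. -/
structure IsConicWithConcurrentLines {F : Type*} [Field F] (P : Set (GeomPP F))
    (c : MvPolynomial (Fin 3) F) (l : Fin 3 → MvPolynomial (Fin 3) F) : Prop where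
  conic : IsCurve 2 c
  conic_irreducible : Irreducible c
  conic_contains : Contains c P
  line : ∀ i, IsCurve 1 (l i)
  distinct : ∀ i j, i ≠ j → ¬ Associated (l i) (l j)
  concurrent : ∃ R : PP F, ∀ i, VanishesAt (l i) R
  disjoint : ∀ i, ∀ R : PP F, ¬ (VanishesAt c R ∧ VanishesAt (l i) R)

open MvPolynomial in
/-- The set of geometric points defined by
`x² + xz + yz = xy + yz + z² = 4xz + y² = 0`. -/
def examplePoint (F : Type*) [Field F] : Set (GeomPP F) :=
  {p | VanishesAt (X 0 ^ 2 + X 0 * X 2 + X 1 * X 2 : MvPolynomial (Fin 3) F) p ∧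
    VanishesAt (X 0 * X 1 + X 1 * X 2 + X 2 ^ 2 : MvPolynomial (Fin 3) F) p ∧
    VanishesAt (4 * X 0 * X 2 + X 1 ^ 2 : MvPolynomial (Fin 3) F) p}

open MvPolynomial in
/-- The explicit quartic form. -/
def exampleQuartic (F : Type*) [Field F] : MvPolynomial (Fin 3) F :=
  let x : MvPolynomial (Fin 3) F := X 0
  let y : MvPolynomial (Fin 3) F := X 1
  let z : MvPolynomial (Fin 3) F := X 2
  x ^ 4 + 2 * x ^ 3 * y + 3 * x ^ 3 * z + 3 * x ^ 2 * y ^ 2 + 4 * x ^ 2 * y * z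
    + 3 * x ^ 2 * z ^ 2 + 2 * x * y ^ 3 + 4 * x * y ^ 2 * z + x * y * z ^ 2 + 3 * x * z ^ 3
    + 2 * y ^ 4 + 4 * y ^ 3 * z + 2 * y ^ 2 * z ^ 2 + 4 * y * z ^ 3 + 2 * z ^ 4

/-- The explicit quintic form: the line `x = 0` together with the explicit quartic. -/
def exampleQuintic (F : Type*) [Field F] : MvPolynomial (Fin 3) F :=
  MvPolynomial.X 0 * exampleQuartic F

end PlaneQuintics

end

/-! Let a curve of degree `d` over the field of `q` elements have `N` rational points and no
rational line as a component. Choose at every rational point a tangent line (any rational line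
through it if the point is singular). Restricting the equation to a line `l` shows that the number
of points on `l`, plus the number of points whose chosen tangent is `l`, is at most `d`. The rest is
counting in a projective plane of order `q`: the deficiencies `d - |C ∩ l|` of the lines through a
point of `C` have the sum `D = (d - 1) q + d - N`, independent of the point. The tangent condition
forces `D ≥ 1`, and `D ≥ 2` if `d ≥ 3`. If `d ≥ 4` and `D = 2`, all the points on a chosen tangent
share it and there are `d - 2` of them, so `2 (d - 2) ≤ d`. This gives `q + 1`, `2q + 1`, `4q + 2`
for `d = 2, 3, 5` (`card_le_two`, `card_le_three`, `card_le_five`).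

For `d = 4` the value `3q + 2` survives the counting, with all tangents bitangent. The points then
fall into pairs, so `q` is even. In characteristic two the gradient of a quartic is conormal to a
bitangent all along it, hence zero where two bitangents meet; this leaves at most seven bitangents,
too few (`numPoints_le_four`).

Rational lines are split off one at a time. The residual curve still passes through `P`, so it never
has degree one, and two lines share a rational point; the bound `e q + 2` in degree `e + 1` follows
by induction (`numPoints_le_of_vanishesAt`).

For equality, a conic through `P` exists by the pigeonhole principle and has exactly `q + 1`
rational points (`numPoints_conic`). Its `q (q - 1) / 2` external lines are too many to have no
three concurrent (`exists_three_concurrent_external`). This works for every `q ≥ 5`, so the explicit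
quintic over the field of five elements is not needed for sharpness. That example consists of the
points `(α² : α : 1)` with `α³ + α + 1 = 0`, and its quintic is handled by finite checks over `ZMod
5`. -/

/-! ### Arcs with tangents in a finite projective plane -/

section Plane

open Configuration Configuration.ProjectivePlane

set_option linter.unusedSectionVars false

open scoped Classical in
/-- The number of points of `C` on the line `l`. -/
noncomputable def secantCount {P L : Type*} [Membership P L] (C : Finset P) (l : L) : ℕ :=
  (C.filter (· ∈ l)).card

variable {P L : Type*} [Membership P L] [Fintype P] [Fintype L] [ProjectivePlane P L]

open scoped Classical in
theorem card_lines_through (p : P) :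
    (Finset.univ.filter fun l : L => p ∈ l).card = order P L + 1 := by
  rw [← lineCount_eq L p, lineCount, Nat.card_eq_fintype_card, Fintype.card_subtype]

open scoped Classical in
theorem card_points_on (l : L) :
    (Finset.univ.filter fun p : P => p ∈ l).card = order P L + 1 := by
  rw [← pointCount_eq P l, pointCount, Nat.card_eq_fintype_card, Fintype.card_subtype]

open scoped Classical in
theorem card_lines_through_two {p x : P} (h : p ≠ x) :
    (Finset.univ.filter fun l : L => p ∈ l ∧ x ∈ l).card = 1 := by
  rw [Finset.card_eq_one]
  refine ⟨HasLines.mkLine h, ?_⟩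
  ext l
  simp only [Finset.mem_filter, Finset.mem_univ, true_and, Finset.mem_singleton]
  constructor
  · rintro ⟨h1, h2⟩
    exact (Nondegenerate.eq_or_eq h1 h2 (HasLines.mkLine_ax h).1
      (HasLines.mkLine_ax h).2).resolve_left h
  · rintro rfl
    exact HasLines.mkLine_ax h

open scoped Classical in
-- Double counting: a point other than `p` lies on exactly one line through `p`, while `p` lies on
-- all `order P L + 1` of them.
theorem sum_secantCount (C : Finset P) (p : P) :
    ∑ l : L with p ∈ l, secantCount C l = C.card + if p ∈ C then order P L else 0 := by
  have h1 : ∑ l : L with p ∈ l, secantCount C l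
      = ∑ x ∈ C, (Finset.univ.filter fun l : L => p ∈ l ∧ x ∈ l).card := by
    simp only [secantCount, Finset.card_filter]
    rw [Finset.sum_comm]
    refine Finset.sum_congr rfl fun x _ => ?_
    rw [Finset.sum_filter]
    refine Finset.sum_congr rfl fun l _ => ?_
    by_cases h : p ∈ l <;> simp [h]
  have h2 : ∀ x ∈ C, (Finset.univ.filter fun l : L => p ∈ l ∧ x ∈ l).card
      = 1 + if p = x then order P L else 0 := by
    intro x _
    split_ifs with h
    · subst h
      simp only [and_self, card_lines_through]
      omega
    · rw [card_lines_through_two h]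
  rw [h1, Finset.sum_congr rfl h2, Finset.sum_add_distrib]
  simp

theorem secantCount_pos {C : Finset P} {x : P} {l : L} (hx : x ∈ C) (hl : x ∈ l) :
    0 < secantCount C l := by
  classical
  exact Finset.card_pos.2 ⟨x, by simp [hx, hl]⟩

open scoped Classical in
/-- For an `(N, d)`-arc the deficiencies of the lines through a point of the arc have a fixed
sum. -/
theorem sum_deficiency {C : Finset P} {d : ℕ} (hd : ∀ l : L, secantCount C l ≤ d) {x : P}
    (hx : x ∈ C) :
    ∑ l : L with x ∈ l, (d - secantCount C l) + C.card + order P L = (order P L + 1) * d := by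
  have h := sum_secantCount (L := L) C x
  rw [if_pos hx] at h
  rw [add_assoc, ← h, ← Finset.sum_add_distrib]
  rw [Finset.sum_congr rfl fun l _ => Nat.sub_add_cancel (hd l), Finset.sum_const,
    card_lines_through, smul_eq_mul]

open scoped Classical in
/-- The number of points of `C` whose chosen tangent is `l`. -/
noncomputable def tangentCount {P L : Type*} (C : Finset P) (t : P → L) (l : L) : ℕ :=
  (C.filter (t · = l)).card

/-- A choice of tangents of the point set `C`, such that each line meets `C` in at most `d` points
counted with multiplicity, the multiplicity being at least two for tangents. -/
structure IsTangentChoice {P L : Type*} [Membership P L] (C : Finset P) (t : P → L) (d : ℕ) :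
    Prop where
  mem : ∀ x ∈ C, x ∈ t x
  le : ∀ l, secantCount C l + tangentCount C t l ≤ d

namespace IsTangentChoice

variable {C : Finset P} {t : P → L} {d : ℕ}

theorem tangentCount_pos {x : P} (hx : x ∈ C) : 0 < tangentCount C t (t x) := by
  classical
  exact Finset.card_pos.2 ⟨x, by simp [hx]⟩

theorem secantCount_le (h : IsTangentChoice C t d) (l : L) : secantCount C l ≤ d :=
  le_trans (Nat.le_add_right _ _) (h.le l)

open scoped Classical in
theorem deficiency_le_sum {x : P} {l : L} (hl : x ∈ l) :
    d - secantCount C l ≤ ∑ l : L with x ∈ l, (d - secantCount C l) :=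
  Finset.single_le_sum (f := fun l : L => d - secantCount C l) (fun _ _ => Nat.zero_le _)
    (by simp [hl])

open scoped Classical in
theorem deficiency_add_le_sum {x : P} {l m : L} (hl : x ∈ l) (hm : x ∈ m) (hlm : l ≠ m) :
    (d - secantCount C l) + (d - secantCount C m)
      ≤ ∑ l : L with x ∈ l, (d - secantCount C l) := by
  rw [← Finset.sum_pair (f := fun l : L => d - secantCount C l) hlm]
  refine Finset.sum_le_sum_of_subset fun z hz => ?_
  rcases Finset.mem_insert.1 hz with rfl | hz
  · simp [hl]
  · rw [Finset.mem_singleton] at hz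
    subst hz
    simp [hm]

theorem tangentCount_eq (h : IsTangentChoice C t d) {l : L} (hl : ∀ x ∈ C, x ∈ l → t x = l) :
    tangentCount C t l = secantCount C l := by
  classical
  unfold tangentCount secantCount
  congr 1
  refine Finset.filter_congr fun x hx => ⟨fun e => e ▸ h.mem x hx, hl x hx⟩

theorem one_le_deficiency (h : IsTangentChoice C t d) {x : P} (hx : x ∈ C) :
    secantCount C (t x) + 1 ≤ d :=
  le_trans (Nat.add_le_add_left (tangentCount_pos hx) _) (h.le _)

open scoped Classical in
-- If the common sum were at most one, each point would lie on only one deficient line, its tangent.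
-- All points of `t x` would then have tangent `t x`, and `2 (d - 1) ≤ d`, which fails for `d ≥ 3`.
theorem two_le_sum (h : IsTangentChoice C t d) (hd : 3 ≤ d) {x : P} (hx : x ∈ C) :
    2 ≤ ∑ l : L with x ∈ l, (d - secantCount C l) := by
  by_contra hlt
  have hsum : ∀ y ∈ C, ∑ l : L with y ∈ l, (d - secantCount C l) ≤ 1 := fun y hy => by
    have h1 := sum_deficiency (L := L) h.secantCount_le hx
    have h2 := sum_deficiency (L := L) h.secantCount_le hy
    omega
  have key : tangentCount C t (t x) = secantCount C (t x) := by
    refine h.tangentCount_eq fun y hy hyl => ?_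
    by_contra hne
    have h1 := (deficiency_add_le_sum (C := C) (d := d) (h.mem y hy) hyl hne).trans (hsum y hy)
    have h2 := h.one_le_deficiency hy
    have h3 := h.one_le_deficiency hx
    omega
  have h1 := (deficiency_le_sum (C := C) (d := d) (h.mem x hx)).trans (hsum x hx)
  have h2 := h.le (t x)
  omega

open scoped Classical in
-- Let `S` be the set of lines of deficiency one, and count incidences of `C` with `S`. A point is
-- on at most two lines of `S`, and on none unless its tangent is in `S`, since otherwise the
-- tangent exhausts the deficiency. A line of `S` is the tangent of at most one point. Hence `|S| (d
-- - 1) ≤ 2 |S|`, and `S` is empty as `d ≥ 4`.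
theorem secantCount_ne_of_sum_eq_two (h : IsTangentChoice C t d) (hd : 4 ≤ d)
    (hD : ∀ x ∈ C, ∑ l : L with x ∈ l, (d - secantCount C l) = 2) (l : L) :
    secantCount C l + 1 ≠ d := by
  set S : Finset L := Finset.univ.filter fun l => secantCount C l + 1 = d with hS
  have hSmem : ∀ l, l ∈ S ↔ secantCount C l + 1 = d := by simp [hS]
  have h1 : ∑ l ∈ S, secantCount C l = ∑ x ∈ C, (S.filter (x ∈ ·)).card := by
    simp only [secantCount, Finset.card_filter]
    rw [Finset.sum_comm]
  have h2 : ∀ x ∈ C, (S.filter (x ∈ ·)).card ≤ if t x ∈ S then 2 else 0 := by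
    intro x hx
    have hx2 : (S.filter (x ∈ ·)).card ≤ 2 := by
      rw [← hD x hx, Finset.card_eq_sum_ones]
      refine (Finset.sum_le_sum fun l hl => ?_).trans
        (Finset.sum_le_sum_of_subset (f := fun l => d - secantCount C l) fun l hl => ?_)
      · have := (hSmem l).1 (Finset.mem_filter.1 hl).1
        omega
      · simpa using (Finset.mem_filter.1 hl).2
    split_ifs with ht
    · exact hx2
    · rw [Nat.le_zero, Finset.card_eq_zero, Finset.filter_eq_empty_iff]
      intro l hl hxl
      have hne : t x ≠ l := fun e => ht (e ▸ hl)
      have h3 := deficiency_add_le_sum (C := C) (d := d) (h.mem x hx) hxl hne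
      rw [hD x hx] at h3
      have h4 := h.one_le_deficiency hx
      have h5 := (hSmem l).1 hl
      exact ht ((hSmem _).2 (by omega))
  have h3 : ∑ x ∈ C, (if t x ∈ S then 2 else 0) = 2 * ∑ l ∈ S, tangentCount C t l := by
    rw [← Finset.sum_filter, Finset.sum_const, smul_eq_mul, mul_comm,
      Finset.card_eq_sum_card_fiberwise (f := t) (t := S) (fun x hx => by simpa using
        (Finset.mem_filter.1 hx).2)]
    congr 1
    refine Finset.sum_congr rfl fun l hl => ?_
    rw [tangentCount, Finset.filter_filter]
    congr 1
    refine Finset.filter_congr fun x _ => ⟨fun e => e.2, fun e => ⟨e ▸ hl, e⟩⟩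
  have h4 : ∑ l ∈ S, secantCount C l = S.card * (d - 1) := by
    rw [Finset.sum_congr rfl (g := fun _ => d - 1), Finset.sum_const, smul_eq_mul]
    intro l hl
    have := (hSmem l).1 hl
    omega
  have h5 : ∑ l ∈ S, tangentCount C t l ≤ S.card * 1 := by
    rw [← smul_eq_mul, ← Finset.sum_const]
    refine Finset.sum_le_sum fun l hl => ?_
    have := (hSmem l).1 hl
    have := h.le l
    omega
  have h6 := Finset.sum_le_sum h2
  intro hl
  have hpos : 0 < S.card := Finset.card_pos.2 ⟨l, (hSmem l).2 hl⟩
  have h7 : S.card * 3 ≤ S.card * (d - 1) := Nat.mul_le_mul_left _ (by omega)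
  omega

open scoped Classical in
-- With deficiency one excluded, the tangent takes the whole deficiency two, so every other line
-- through the point is full. A point of `t x` with a different tangent would make `t x` full, a
-- contradiction.
theorem bitangent_of_sum_eq_two (h : IsTangentChoice C t d) (hd : 4 ≤ d)
    (hD : ∀ x ∈ C, ∑ l : L with x ∈ l, (d - secantCount C l) = 2) {x : P} (hx : x ∈ C) :
    secantCount C (t x) + 2 = d ∧ tangentCount C t (t x) = secantCount C (t x) ∧
      ∀ l, x ∈ l → l ≠ t x → secantCount C l = d := by
  have hdef : ∀ y ∈ C, secantCount C (t y) + 2 = d := fun y hy => by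
    have h1 := h.one_le_deficiency hy
    have h2 := (deficiency_le_sum (C := C) (d := d) (h.mem y hy)).trans (hD y hy).le
    have h3 := h.secantCount_ne_of_sum_eq_two hd hD (t y)
    omega
  have hoth : ∀ y ∈ C, ∀ l, y ∈ l → l ≠ t y → secantCount C l = d := fun y hy l hyl hne => by
    have h1 := deficiency_add_le_sum (C := C) (d := d) (h.mem y hy) hyl hne.symm
    rw [hD y hy] at h1
    have h2 := hdef y hy
    have h3 := h.secantCount_le l
    omega
  refine ⟨hdef x hx, h.tangentCount_eq fun y hy hyl => ?_, hoth x hx⟩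
  by_contra hne
  have h1 := hoth y hy _ hyl (Ne.symm hne)
  have h2 := hdef x hx
  omega

theorem card_le_two (h : IsTangentChoice C t 2) : C.card ≤ order P L + 1 := by
  classical
  rcases C.eq_empty_or_nonempty with rfl | ⟨x, hx⟩
  · simp
  have h1 := sum_deficiency (L := L) h.secantCount_le hx
  have h2 := deficiency_le_sum (C := C) (d := 2) (h.mem x hx)
  have h3 := h.one_le_deficiency hx
  omega

theorem card_le_three (h : IsTangentChoice C t 3) : C.card ≤ 2 * order P L + 1 := by
  classical
  rcases C.eq_empty_or_nonempty with rfl | ⟨x, hx⟩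
  · simp
  have h1 := sum_deficiency (L := L) h.secantCount_le hx
  have h2 := h.two_le_sum le_rfl hx
  omega

open scoped Classical in
theorem sum_eq_two (h : IsTangentChoice C t d)
    (hC : C.card + order P L + 2 = (order P L + 1) * d) {x : P} (hx : x ∈ C) :
    ∑ l : L with x ∈ l, (d - secantCount C l) = 2 := by
  have h1 := sum_deficiency (L := L) h.secantCount_le hx
  omega

/-- One more point would make the deficiency sum two, and the tangent would count `3 + 3 > 5`. -/
theorem card_le_five (h : IsTangentChoice C t 5) : C.card ≤ 4 * order P L + 2 := by
  classical
  rcases C.eq_empty_or_nonempty with rfl | ⟨x, hx⟩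
  · simp
  have h1 := sum_deficiency (L := L) h.secantCount_le hx
  have h2 := h.two_le_sum (by norm_num) hx
  by_contra hlt
  have h3 := h.bitangent_of_sum_eq_two (by norm_num)
    (fun y hy => h.sum_eq_two (by omega) hy) hx
  have h4 := h.le (t x)
  omega

/-- Here `2 + 2 = 4` is no contradiction; the extremal configuration is kept and is excluded later
by algebra. -/
theorem card_le_four (h : IsTangentChoice C t 4) : C.card ≤ 3 * order P L + 1 ∨
    (C.card = 3 * order P L + 2 ∧ ∀ x ∈ C, secantCount C (t x) = 2 ∧ tangentCount C t (t x) = 2 ∧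
      ∀ l, x ∈ l → l ≠ t x → secantCount C l = 4) := by
  classical
  rcases C.eq_empty_or_nonempty with rfl | ⟨x, hx⟩
  · simp
  have h1 := sum_deficiency (L := L) h.secantCount_le hx
  have h2 := h.two_le_sum (by norm_num) hx
  rcases Nat.lt_or_ge C.card (3 * order P L + 2) with hlt | hge
  · exact Or.inl (by omega)
  · have hC : C.card = 3 * order P L + 2 := by omega
    refine Or.inr ⟨hC, fun y hy => ?_⟩
    have h3 := h.bitangent_of_sum_eq_two (by norm_num)
      (fun y hy => h.sum_eq_two (by omega) hy) hy
    exact ⟨by omega, by omega, h3.2.2⟩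

end IsTangentChoice

open scoped Classical in
/-- A set of `n + 1` points with at most two on each line, in a plane of order `n ≥ 5`, admits three
concurrent lines that miss it. -/
theorem exists_three_concurrent_external {C : Finset P} (hn : 5 ≤ order P L)
    (hC : C.card = order P L + 1) (h2 : ∀ l : L, secantCount C l ≤ 2) :
    ∃ p : P, 3 ≤ (Finset.univ.filter fun l : L => p ∈ l ∧ secantCount C l = 0).card := by
  set n := order P L with hnd
  set E : Finset L := Finset.univ.filter fun l => secantCount C l = 0 with hE
  have hsq : ∑ l : L, secantCount C l = (n + 1) * (n + 1) := by
    have : ∑ l : L, secantCount C l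
        = ∑ x ∈ C, (Finset.univ.filter fun l : L => x ∈ l).card := by
      simp only [secantCount, Finset.card_filter]
      rw [Finset.sum_comm]
    rw [this, Finset.sum_congr rfl fun x _ => card_lines_through x, Finset.sum_const, hC,
      smul_eq_mul]
  have hsq2 : ∑ l : L, secantCount C l * secantCount C l = (n + 1) * (2 * n + 1) := by
    have : ∀ l : L, secantCount C l * secantCount C l
        = ∑ x ∈ C, if x ∈ l then secantCount C l else 0 := by
      intro l
      rw [← Finset.sum_filter, Finset.sum_const, smul_eq_mul, secantCount]
    rw [Finset.sum_congr rfl fun l _ => this l, Finset.sum_comm]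
    have h3 : ∀ x ∈ C, (∑ l : L, if x ∈ l then secantCount C l else 0) = 2 * n + 1 := by
      intro x hx
      rw [← Finset.sum_filter, sum_secantCount, if_pos hx, hC]
      omega
    rw [Finset.sum_congr rfl h3, Finset.sum_const, hC, smul_eq_mul]
  have hLcard : Fintype.card L = n ^ 2 + n + 1 := card_lines P L
  have hEcard : 2 * E.card = n * (n - 1) := by
    -- For `s` in `{0, 1, 2}` the indicator of `s = 0` is `(s - 1) (s - 2) / 2`, so the first two
    -- moments of `secantCount` determine the number of external lines.
    have h3 : ∀ l : L, 2 * (if secantCount C l = 0 then 1 else 0) + 3 * secantCount C l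
        = 2 + secantCount C l * secantCount C l := by
      intro l
      have := h2 l
      interval_cases secantCount C l <;> simp
    have h4 := Finset.sum_congr rfl fun l (_ : l ∈ Finset.univ) => h3 l
    rw [Finset.sum_add_distrib, Finset.sum_add_distrib, ← Finset.mul_sum, ← Finset.mul_sum, hsq,
      hsq2, ← Finset.card_filter, Finset.sum_const, Finset.card_univ, hLcard, smul_eq_mul] at h4
    obtain ⟨m, hm⟩ : ∃ m, n = m + 1 := ⟨n - 1, by omega⟩
    rw [hm] at h4 ⊢
    simp only [Nat.add_sub_cancel]
    rw [← hE] at h4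
    linarith
  obtain ⟨m, hm⟩ : E.Nonempty := by
    rw [← Finset.card_pos]
    have : 0 < n * (n - 1) := Nat.mul_pos (by omega) (by omega)
    omega
  by_contra hcon
  push Not at hcon
  -- Every other external line meets the external line `m` once, and `m` itself is counted at each
  -- of its `n + 1` points.
  have hinc : ∑ p : P with p ∈ m, (E.filter (p ∈ ·)).card = E.card + n := by
    have h5 : ∑ p : P with p ∈ m, (E.filter (p ∈ ·)).card
        = ∑ l ∈ E, (Finset.univ.filter fun p : P => p ∈ m ∧ p ∈ l).card := by
      simp only [Finset.card_filter]
      rw [Finset.sum_comm]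
      refine Finset.sum_congr rfl fun x _ => ?_
      rw [Finset.sum_filter]
      refine Finset.sum_congr rfl fun l _ => ?_
      by_cases h : l ∈ m <;> simp [h]
    have h6 : ∀ l ∈ E, (Finset.univ.filter fun p : P => p ∈ m ∧ p ∈ l).card
        = 1 + if m = l then n else 0 := by
      intro l _
      split_ifs with h
      · subst h
        simp only [and_self, card_points_on]
        omega
      · rw [Finset.card_eq_one]
        refine ⟨HasPoints.mkPoint h, ?_⟩
        ext p
        simp only [Finset.mem_filter, Finset.mem_univ, true_and, Finset.mem_singleton]
        constructor
        · rintro ⟨h1, h2⟩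
          exact (Nondegenerate.eq_or_eq h1 (HasPoints.mkPoint_ax h).1 h2
            (HasPoints.mkPoint_ax h).2).resolve_right h
        · rintro rfl
          exact HasPoints.mkPoint_ax h
    rw [h5, Finset.sum_congr rfl h6, Finset.sum_add_distrib, Finset.sum_ite_eq, if_pos hm]
    simp
  have hle : ∑ p : P with p ∈ m, (E.filter (p ∈ ·)).card ≤ (n + 1) * 2 := by
    rw [hnd, ← card_points_on (P := P) m, ← smul_eq_mul, ← Finset.sum_const]
    refine Finset.sum_le_sum fun p _ => ?_
    have := hcon p
    rw [hE, Finset.filter_filter]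
    simp only [and_comm] at this ⊢
    omega
  -- At most two external lines at each point of `m` would give `|E| ≤ n + 2`, whereas `|E| = n (n -
  -- 1) / 2 ≥ 2n`.
  have h7 : n * 4 ≤ n * (n - 1) := Nat.mul_le_mul_left _ (by omega)
  omega

end Plane

/-! ### Factors of homogeneous polynomials -/

namespace PlaneQuintics

open MvPolynomial

section Homogeneous

variable {σ R : Type*} [CommRing R]

theorem homogeneousComponent_mul_of_isHomogeneous {a : MvPolynomial σ R} {i : ℕ}
    (ha : a.IsHomogeneous i) (b : MvPolynomial σ R) (n : ℕ) :
    homogeneousComponent (i + n) (a * b) = a * homogeneousComponent n b := by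
  conv_lhs => rw [← sum_homogeneousComponent b, Finset.mul_sum, map_sum]
  have h : ∀ k ∈ Finset.range (b.totalDegree + 1),
      homogeneousComponent (i + n) (a * homogeneousComponent k b)
        = if n = k then a * homogeneousComponent k b else 0 := fun k _ => by
    rw [homogeneousComponent_of_mem (ha.mul (homogeneousComponent_isHomogeneous k b))]
    simp
  rw [Finset.sum_congr rfl h, Finset.sum_ite_eq]
  split_ifs with hn
  · rfl
  · rw [homogeneousComponent_eq_zero, mul_zero]
    simpa [Nat.lt_succ_iff] using hn

theorem homogeneousComponent_totalDegree_mul (a b : MvPolynomial σ R) :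
    homogeneousComponent (a.totalDegree + b.totalDegree) (a * b)
      = homogeneousComponent a.totalDegree a * homogeneousComponent b.totalDegree b := by
  conv_lhs => rw [← sum_homogeneousComponent a, Finset.sum_mul, map_sum]
  rw [sum_homogeneousComponent, Finset.sum_eq_single a.totalDegree]
  · exact homogeneousComponent_mul_of_isHomogeneous (homogeneousComponent_isHomogeneous _ a) b _
  · intro k hk hne
    have hlt : k < a.totalDegree := lt_of_le_of_ne (by simpa [Nat.lt_succ_iff] using hk) hne
    rw [show a.totalDegree + b.totalDegree = k + (b.totalDegree + (a.totalDegree - k)) by omega,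
      homogeneousComponent_mul_of_isHomogeneous (homogeneousComponent_isHomogeneous _ a),
      homogeneousComponent_eq_zero _ b (by omega), mul_zero]
  · simp

theorem isHomogeneous_of_mul_left [IsDomain R] {a b : MvPolynomial σ R} {i n : ℕ} (ha0 : a ≠ 0)
    (ha : a.IsHomogeneous i) (hab : (a * b).IsHomogeneous (i + n)) : b.IsHomogeneous n := by
  have h := homogeneousComponent_mul_of_isHomogeneous ha b n
  rw [homogeneousComponent_of_mem hab, if_pos rfl] at h
  rw [mul_left_cancel₀ ha0 h]
  exact homogeneousComponent_isHomogeneous n b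

end Homogeneous

variable {F : Type*} [Field F]

/-- In a factorization of a form the top homogeneous components of the factors already multiply to
the form, so only homogeneous factorizations need to be excluded. -/
theorem irreducible_of_forall_ne_mul {σ : Type*} {f : MvPolynomial σ F} {d : ℕ}
    (hf : f.IsHomogeneous d) (hf0 : f ≠ 0) (hd : 0 < d)
    (h : ∀ m n : ℕ, ∀ A B : MvPolynomial σ F, 1 ≤ m → 1 ≤ n → m + n = d → A.IsHomogeneous m →
      B.IsHomogeneous n → f ≠ A * B) : Irreducible f := by
  have hunit : ∀ a : MvPolynomial σ F, a ≠ 0 → ¬ IsUnit a → 1 ≤ a.totalDegree := by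
    intro a ha hu
    by_contra hlt
    rw [Nat.not_le, Nat.lt_one_iff, totalDegree_eq_zero_iff_eq_C] at hlt
    refine hu ?_
    rw [hlt]
    refine (IsUnit.mk0 _ fun h0 => ha ?_).map C
    rw [hlt, h0, C_0]
  constructor
  · intro hu
    have h1 := hf.totalDegree hf0
    obtain ⟨g, hg⟩ := hu.exists_right_inv
    have hg0 : g ≠ 0 := by rintro rfl; simp at hg
    have h2 := totalDegree_mul_of_isDomain hf0 hg0
    rw [hg, totalDegree_one] at h2
    omega
  · intro a b hab
    by_contra hcon
    push Not at hcon
    have ha0 : a ≠ 0 := by rintro rfl; exact hf0 (by simpa using hab)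
    have hb0 : b ≠ 0 := by rintro rfl; exact hf0 (by simpa using hab)
    have hdeg : a.totalDegree + b.totalDegree = d := by
      rw [← totalDegree_mul_of_isDomain ha0 hb0, ← hab, hf.totalDegree hf0]
    refine h _ _ _ _ (hunit a ha0 hcon.1) (hunit b hb0 hcon.2) hdeg
      (homogeneousComponent_isHomogeneous _ a) (homogeneousComponent_isHomogeneous _ b) ?_
    rw [← homogeneousComponent_totalDegree_mul, ← hab, hdeg, homogeneousComponent_of_mem hf,
      if_pos rfl]

/-! ### Linear forms, restriction to a line, gradients -/

/-- The linear form with coefficient vector `a`. -/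
noncomputable def linForm (a : Fin 3 → F) : MvPolynomial (Fin 3) F := ∑ i, C (a i) * X i

theorem linForm_isHomogeneous (a : Fin 3 → F) : (linForm a).IsHomogeneous 1 :=
  IsHomogeneous.sum _ _ _ fun i _ => (isHomogeneous_X F i).C_mul (a i)

theorem aeval_linForm {K : Type*} [Field K] [Algebra F K] (a : Fin 3 → F) (x : Fin 3 → K) :
    aeval x (linForm a) = ∑ i, algebraMap F K (a i) * x i := by
  simp [linForm]

theorem aeval_linForm_self (a x : Fin 3 → F) : aeval x (linForm a) = x ⬝ᵥ a := by
  simp [linForm, dotProduct, mul_comm]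

theorem linForm_injective : Function.Injective (linForm (F := F)) := by
  intro a b h
  ext i
  have := congrArg (aeval (Pi.single i (1 : F))) h
  simpa [aeval_linForm_self] using this

theorem linForm_ne_zero {a : Fin 3 → F} (ha : a ≠ 0) : linForm a ≠ 0 := fun h =>
  ha (linForm_injective (h.trans (by simp [linForm])))

theorem isCurve_linForm {a : Fin 3 → F} (ha : a ≠ 0) : IsCurve 1 (linForm a) :=
  ⟨linForm_ne_zero ha, linForm_isHomogeneous a⟩

/-- Euler's identity, the partial derivatives of a linear form being constants. -/
theorem exists_eq_linForm {l : MvPolynomial (Fin 3) F} (hl : l.IsHomogeneous 1) :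
    ∃ a, l = linForm a := by
  refine ⟨fun i => coeff 0 (pderiv i l), ?_⟩
  have h := hl.sum_X_mul_pderiv
  rw [one_smul] at h
  rw [← h, linForm]
  refine Finset.sum_congr rfl fun i _ => ?_
  have h1 : (pderiv i l).IsHomogeneous 0 := hl.pderiv
  rw [← totalDegree_zero_iff_isHomogeneous, totalDegree_eq_zero_iff_eq_C] at h1
  conv_lhs => rw [h1, mul_comm]
  rw [h]

/-- The restriction of `f` to the parametrized line `t ↦ v + t w`. -/
noncomputable def linePoly (f : MvPolynomial (Fin 3) F) (v w : Fin 3 → F) : Polynomial F :=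
  aeval (fun i => Polynomial.C (v i) + Polynomial.C (w i) * Polynomial.X) f

theorem eval_linePoly (f : MvPolynomial (Fin 3) F) (v w : Fin 3 → F) (t : F) :
    (linePoly f v w).eval t = aeval (v + t • w) f := by
  rw [linePoly, ← Polynomial.coe_aeval_eq_eval]
  refine (MvPolynomial.comp_aeval_apply _ (Polynomial.aeval t) f).trans ?_
  have h : (fun i => Polynomial.aeval t (Polynomial.C (v i) + Polynomial.C (w i) * Polynomial.X))
      = v + t • w := by
    funext i
    rw [Polynomial.coe_aeval_eq_eval, Polynomial.eval_add, Polynomial.eval_C_mul,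
      Polynomial.eval_C, Polynomial.eval_X, mul_comm]
    rfl
  rw [h]

/-- Exchanging `v` and `w` reverses each factor `v i + w i X`, hence the whole polynomial. This
gives access to `w`, the point at infinity of the parametrization: the value of `f` there is the
coefficient of degree `d`. -/
theorem natDegree_linePoly_le_and_reflect {f : MvPolynomial (Fin 3) F} {d : ℕ}
    (hf : f.IsHomogeneous d) (v w : Fin 3 → F) :
    (linePoly f v w).natDegree ≤ d ∧ (linePoly f v w).reflect d = linePoly f w v := by
  have hlin : ∀ a b : F, (Polynomial.C a + Polynomial.C b * Polynomial.X).natDegree ≤ 1 ∧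
      (Polynomial.C a + Polynomial.C b * Polynomial.X).reflect 1
        = Polynomial.C b + Polynomial.C a * Polynomial.X := by
    intro a b
    refine ⟨by compute_degree, ?_⟩
    rw [Polynomial.reflect_add, Polynomial.reflect_C_mul, Polynomial.reflect_one_X,
      Polynomial.reflect_C, pow_one, mul_one, add_comm]
  have hpow : ∀ (a b : F) (n : ℕ),
      ((Polynomial.C a + Polynomial.C b * Polynomial.X) ^ n).natDegree ≤ n ∧
      ((Polynomial.C a + Polynomial.C b * Polynomial.X) ^ n).reflect n
        = (Polynomial.C b + Polynomial.C a * Polynomial.X) ^ n := by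
    intro a b n
    induction n with
    | zero => simp
    | succ n ih =>
      refine ⟨?_, ?_⟩
      · rw [pow_succ]
        exact Polynomial.natDegree_mul_le.trans (Nat.add_le_add ih.1 (hlin a b).1)
      · rw [pow_succ, Polynomial.reflect_mul _ _ ih.1 (hlin a b).1, ih.2, (hlin a b).2, pow_succ]
  have hmon : ∀ m ∈ f.support,
      (Polynomial.C (coeff m f) * ∏ i, (Polynomial.C (v i) + Polynomial.C (w i) * Polynomial.X)
        ^ m i).natDegree ≤ d ∧
      (Polynomial.C (coeff m f) * ∏ i, (Polynomial.C (v i) + Polynomial.C (w i) * Polynomial.X)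
        ^ m i).reflect d = Polynomial.C (coeff m f) *
          ∏ i, (Polynomial.C (w i) + Polynomial.C (v i) * Polynomial.X) ^ m i := by
    intro m hm
    have hd : m 0 + m 1 + m 2 = d := by
      have h := hf (mem_support_iff.1 hm)
      rw [← Fin.sum_univ_three (fun i => m i)]
      rw [← h, Finsupp.weight_apply, Finsupp.sum_fintype _ _ (by simp)]
      simp
    rw [Fin.prod_univ_three, Fin.prod_univ_three]
    have h01 := Polynomial.natDegree_mul_le.trans
      (Nat.add_le_add (hpow (v 0) (w 0) (m 0)).1 (hpow (v 1) (w 1) (m 1)).1)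
    have h012 := Polynomial.natDegree_mul_le.trans
      (Nat.add_le_add h01 (hpow (v 2) (w 2) (m 2)).1)
    rw [hd] at h012
    refine ⟨(Polynomial.natDegree_C_mul_le _ _).trans h012, ?_⟩
    rw [Polynomial.reflect_C_mul, ← hd,
      Polynomial.reflect_mul _ _ h01 (hpow (v 2) (w 2) (m 2)).1,
      Polynomial.reflect_mul _ _ (hpow (v 0) (w 0) (m 0)).1 (hpow (v 1) (w 1) (m 1)).1,
      (hpow _ _ _).2, (hpow _ _ _).2, (hpow _ _ _).2]
  have hsum : ∀ v w : Fin 3 → F, linePoly f v w = ∑ m ∈ f.support, Polynomial.C (coeff m f) *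
      ∏ i, (Polynomial.C (v i) + Polynomial.C (w i) * Polynomial.X) ^ m i := by
    intro v w
    rw [linePoly, aeval_def, eval₂_eq']
    rfl
  refine ⟨?_, ?_⟩
  · rw [hsum]
    exact Polynomial.natDegree_sum_le_of_forall_le _ _ fun m hm => (hmon m hm).1
  · rw [hsum, hsum w v]
    have hadd : ∀ s : Finset (Fin 3 →₀ ℕ), ∀ g : (Fin 3 →₀ ℕ) → Polynomial F,
        (∑ m ∈ s, g m).reflect d = ∑ m ∈ s, (g m).reflect d := by
      classical
      intro s g
      induction s using Finset.induction_on with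
      | empty => simp
      | insert a s ha ih => rw [Finset.sum_insert ha, Finset.sum_insert ha,
          Polynomial.reflect_add, ih]
    rw [hadd]
    exact Finset.sum_congr rfl fun m hm => (hmon m hm).2

theorem natDegree_linePoly_le {f : MvPolynomial (Fin 3) F} {d : ℕ}
    (hf : f.IsHomogeneous d) (v w : Fin 3 → F) : (linePoly f v w).natDegree ≤ d :=
  (natDegree_linePoly_le_and_reflect hf v w).1

theorem coeff_linePoly {f : MvPolynomial (Fin 3) F} {d : ℕ} (hf : f.IsHomogeneous d)
    (v w : Fin 3 → F) {i : ℕ} (hi : i ≤ d) :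
    (linePoly f v w).coeff i = (linePoly f w v).coeff (d - i) := by
  rw [← (natDegree_linePoly_le_and_reflect hf w v).2, Polynomial.coeff_reflect,
    Polynomial.revAt_le hi]

theorem coeff_zero_linePoly (f : MvPolynomial (Fin 3) F) (v w : Fin 3 → F) :
    (linePoly f v w).coeff 0 = aeval v f := by
  rw [Polynomial.coeff_zero_eq_eval_zero, eval_linePoly, zero_smul, add_zero]

theorem coeff_degree_linePoly {f : MvPolynomial (Fin 3) F} {d : ℕ} (hf : f.IsHomogeneous d)
    (v w : Fin 3 → F) : (linePoly f v w).coeff d = aeval w f := by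
  rw [coeff_linePoly hf v w le_rfl, Nat.sub_self, coeff_zero_linePoly]

/-- The derivative of `f` in the direction `w`. -/
noncomputable def dirDeriv (w : Fin 3 → F) (f : MvPolynomial (Fin 3) F) :
    MvPolynomial (Fin 3) F := ∑ i, C (w i) * pderiv i f

theorem dirDeriv_isHomogeneous {f : MvPolynomial (Fin 3) F} {d : ℕ} (hf : f.IsHomogeneous d)
    (w : Fin 3 → F) : (dirDeriv w f).IsHomogeneous (d - 1) :=
  IsHomogeneous.sum _ _ _ fun i _ => hf.pderiv.C_mul (w i)

theorem derivative_linePoly (f : MvPolynomial (Fin 3) F) (v w : Fin 3 → F) :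
    (linePoly f v w).derivative = linePoly (dirDeriv w f) v w := by
  induction f using MvPolynomial.induction_on with
  | C a => simp [linePoly, dirDeriv]
  | add p q hp hq =>
    have : dirDeriv w (p + q) = dirDeriv w p + dirDeriv w q := by
      simp [dirDeriv, mul_add, Finset.sum_add_distrib]
    rw [this]
    simp only [linePoly, map_add] at hp hq ⊢
    rw [hp, hq]
  | mul_X p i hp =>
    have : dirDeriv w (p * X i) = dirDeriv w p * X i + C (w i) * p := by
      simp only [dirDeriv, Derivation.leibniz, pderiv_X, smul_eq_mul, mul_add,
        Finset.sum_add_distrib, Finset.sum_mul]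
      rw [add_comm]
      congr 1
      · exact Finset.sum_congr rfl fun j _ => by ring
      · rw [Finset.sum_eq_single i]
        · simp
        · intro j _ hj
          simp [Pi.single_eq_of_ne hj.symm]
        · simp
    rw [this]
    simp only [linePoly, map_add, map_mul, aeval_X, Polynomial.derivative_mul, aeval_C] at hp ⊢
    rw [hp]
    simp [Polynomial.algebraMap_eq]
    ring

/-- The gradient of `f` at `x`. -/
noncomputable def grad (f : MvPolynomial (Fin 3) F) (x : Fin 3 → F) : Fin 3 → F :=
  fun i => aeval x (pderiv i f)

theorem aeval_dirDeriv (f : MvPolynomial (Fin 3) F) (x w : Fin 3 → F) :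
    aeval x (dirDeriv w f) = w ⬝ᵥ grad f x := by
  simp [dirDeriv, dotProduct, grad]

theorem dotProduct_grad_self {f : MvPolynomial (Fin 3) F} {d : ℕ} (hf : f.IsHomogeneous d)
    (x : Fin 3 → F) : x ⬝ᵥ grad f x = d * aeval x f := by
  have h := congrArg (aeval x) hf.sum_X_mul_pderiv
  simpa [dotProduct, grad] using h

theorem grad_smul {f : MvPolynomial (Fin 3) F} {d : ℕ} (hf : f.IsHomogeneous d) (a : F)
    (x : Fin 3 → F) : grad f (a • x) = a ^ (d - 1) • grad f x := by
  ext i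
  simp only [grad, Pi.smul_apply, smul_eq_mul]
  exact aeval_smul_of_isHomogeneous hf.pderiv a x

theorem coeff_one_linePoly (f : MvPolynomial (Fin 3) F) (v w : Fin 3 → F) :
    (linePoly f v w).coeff 1 = w ⬝ᵥ grad f v := by
  have h := Polynomial.coeff_derivative (linePoly f v w) 0
  simp only [zero_add, Nat.cast_zero, mul_one] at h
  rw [← h, derivative_linePoly, coeff_zero_linePoly, aeval_dirDeriv]

end PlaneQuintics

/-! ### Points and lines in coordinates -/

namespace PlaneQuintics

open MvPolynomial Configuration Configuration.ProjectivePlane Configuration.ofField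

section Vectors

variable {F : Type*} [Field F]

theorem mk_mem_iff {x : Fin 3 → F} (hx : x ≠ 0) (l : PP F) :
    Projectivization.mk F x hx ∈ l ↔ x ⬝ᵥ l.rep = 0 := by
  conv_lhs => rw [← Projectivization.mk_rep l]
  exact Projectivization.orthogonal_mk hx l.rep_nonzero

theorem mem_mk_iff {x : Fin 3 → F} (hx : x ≠ 0) (p : PP F) :
    p ∈ Projectivization.mk F x hx ↔ p.rep ⬝ᵥ x = 0 := by
  conv_lhs => rw [← Projectivization.mk_rep p]
  exact Projectivization.orthogonal_mk p.rep_nonzero hx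

theorem mem_line_iff (p l : PP F) : p ∈ l ↔ p.rep ⬝ᵥ l.rep = 0 := by
  conv_lhs => rw [← Projectivization.mk_rep p]
  exact mk_mem_iff _ _

theorem vanishesAt_linForm_mk {a : Fin 3 → F} (ha : a ≠ 0) (p : PP F) :
    VanishesAt (linForm a) p ↔ p ∈ Projectivization.mk F a ha := by
  rw [mem_mk_iff, VanishesAt, aeval_linForm_self]

theorem vanishesAt_linForm_rep (l p : PP F) : VanishesAt (linForm l.rep) p ↔ p ∈ l := by
  rw [mem_line_iff, VanishesAt, aeval_linForm_self]

/-- Otherwise `x, v, w` would be a basis of the space, on which the nonzero functional given by `a`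
vanishes. -/
theorem exists_combination {a v w x : Fin 3 → F} (ha : a ≠ 0)
    (hvw : LinearIndependent F ![v, w]) (hv : v ⬝ᵥ a = 0) (hw : w ⬝ᵥ a = 0) (hx : x ⬝ᵥ a = 0) :
    ∃ s t : F, x = s • v + t • w := by
  by_contra hcon
  push Not at hcon
  have h3 : LinearIndependent F ![x, v, w] := by
    refine linearIndependent_finCons.2 ⟨hvw, fun hmem => ?_⟩
    rw [Matrix.range_cons, Matrix.range_cons, Matrix.range_empty, Set.union_empty,
      Set.singleton_union, Submodule.mem_span_pair] at hmem
    obtain ⟨s, t, h⟩ := hmem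
    exact hcon s t h.symm
  have hspan := h3.span_eq_top_of_card_eq_finrank' (by simp)
  refine ha (dotProduct_eq_zero_iff.1 fun y => ?_)
  have hy : y ∈ Submodule.span F (Set.range ![x, v, w]) := hspan ▸ Submodule.mem_top
  rw [dotProduct_comm]
  induction hy using Submodule.span_induction with
  | mem y hy =>
    obtain ⟨i, rfl⟩ := hy
    fin_cases i
    · exact hx
    · exact hv
    · exact hw
  | zero => simp
  | add y z _ _ hy hz => rw [add_dotProduct, hy, hz, add_zero]
  | smul c y _ hy => rw [smul_dotProduct, hy, smul_zero]

theorem linearIndependent_rep {v w : PP F} (h : v ≠ w) : LinearIndependent F ![v.rep, w.rep] :=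
  Projectivization.linearIndependent_pair_iff_ne.2 h

theorem rep_add_smul_ne_zero {v w : PP F} (h : v ≠ w) (t : F) : v.rep + t • w.rep ≠ 0 := by
  intro h0
  refine h ?_
  rw [← v.mk_rep, ← w.mk_rep, Projectivization.mk_eq_mk_iff']
  exact ⟨-t, by rw [neg_smul, eq_neg_of_add_eq_zero_left h0]⟩

theorem exists_eq_mk_add_smul {l v w x : PP F} (hvw : v ≠ w) (hv : v ∈ l) (hw : w ∈ l) (hx : x ∈ l)
    (hxw : x ≠ w) : ∃ t : F, x = Projectivization.mk F _ (rep_add_smul_ne_zero hvw t) := by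
  rw [mem_line_iff] at hv hw hx
  obtain ⟨s, t, h⟩ := exists_combination l.rep_nonzero (linearIndependent_rep hvw) hv hw hx
  have hs : s ≠ 0 := by
    rintro rfl
    rw [zero_smul, zero_add] at h
    refine hxw ?_
    rw [← x.mk_rep, ← w.mk_rep, Projectivization.mk_eq_mk_iff']
    exact ⟨t, h.symm⟩
  refine ⟨s⁻¹ * t, ?_⟩
  conv_lhs => rw [← x.mk_rep]
  rw [Projectivization.mk_eq_mk_iff']
  refine ⟨s, ?_⟩
  rw [h, smul_add, smul_smul, mul_inv_cancel_left₀ hs]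

theorem mk_add_smul_mem {l v w : PP F} (hvw : v ≠ w) (hv : v ∈ l) (hw : w ∈ l) (t : F) :
    Projectivization.mk F _ (rep_add_smul_ne_zero hvw t) ∈ l := by
  rw [mem_line_iff] at hv hw
  rw [mk_mem_iff, add_dotProduct, smul_dotProduct, hv, hw, smul_zero, add_zero]

theorem grad_rep_mk_smul {f : MvPolynomial (Fin 3) F} {d : ℕ} (hf : f.IsHomogeneous d)
    {v : Fin 3 → F} (hv : v ≠ 0) :
    ∃ a : F, a ≠ 0 ∧ grad f (Projectivization.mk F v hv).rep = a • grad f v := by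
  obtain ⟨a, ha⟩ := Projectivization.exists_smul_eq_mk_rep F v hv
  exact ⟨(a : F) ^ (d - 1), pow_ne_zero _ a.ne_zero, by
    rw [← ha, Units.smul_def, grad_smul hf]⟩

theorem dotProduct_grad_mk {f : MvPolynomial (Fin 3) F} {d : ℕ} (hf : f.IsHomogeneous d)
    {v : Fin 3 → F} (hv : v ≠ 0) (y : Fin 3 → F) :
    y ⬝ᵥ grad f (Projectivization.mk F v hv).rep = 0 ↔ y ⬝ᵥ grad f v = 0 := by
  obtain ⟨a, ha, h⟩ := grad_rep_mk_smul hf hv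
  rw [h, dotProduct_smul, smul_eq_zero]
  simp [ha]

end Vectors

/-! ### Rational points and tangents of curves over a finite field -/

section Finite

variable {F : Type*} [Field F] [Fintype F]

set_option linter.unusedSectionVars false

noncomputable instance : Fintype (PP F) := Fintype.ofFinite _

open scoped Classical in
theorem order_PP : order (PP F) (PP F) = Fintype.card F := by
  have h1 := card_points (PP F) (PP F)
  have h2 := Projectivization.card_of_finrank F (Fin 3 → F) (n := 3) (by simp)
  rw [Nat.card_eq_fintype_card, h1, Finset.sum_range_succ, Finset.sum_range_succ,
    Finset.sum_range_one, Nat.card_eq_fintype_card] at h2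
  nlinarith

open scoped Classical in
theorem exists_mem_ne (l w : PP F) : ∃ v : PP F, v ∈ l ∧ v ≠ w := by
  have h := card_points_on (P := PP F) l
  have h1 := one_lt_order (PP F) (PP F)
  by_contra hcon
  push Not at hcon
  have : (Finset.univ.filter fun p : PP F => p ∈ l).card ≤ ({w} : Finset (PP F)).card :=
    Finset.card_le_card fun v hv => by simpa using hcon v (by simpa using hv)
  rw [Finset.card_singleton] at this
  omega

open scoped Classical in
/-- The rational points of the curve `f = 0`. -/
noncomputable def curvePoints (f : MvPolynomial (Fin 3) F) : Finset (PP F) :=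
  Finset.univ.filter (VanishesAt f)

theorem mem_curvePoints {f : MvPolynomial (Fin 3) F} {p : PP F} :
    p ∈ curvePoints f ↔ VanishesAt f p := by
  simp [curvePoints]

theorem numPoints_eq (f : MvPolynomial (Fin 3) F) : numPoints f = (curvePoints f).card := by
  rw [numPoints, ← Set.ncard_coe_finset]
  congr 1
  ext p
  simp [mem_curvePoints]

/-- The line `l` meets `f = 0` with multiplicity at least two at `x`, or `x` is not on it. -/
def IsTangentLine (f : MvPolynomial (Fin 3) F) (x l : PP F) : Prop :=
  ∀ y ∈ l, y.rep ⬝ᵥ grad f x.rep = 0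

/-- Elements of `S` are roots of multiplicity at least two; the roots are counted with multiplicity.
-/
theorem card_roots_add_card_le {K : Type*} [Field K] {p : Polynomial K} (hp : p ≠ 0)
    {R S : Finset K} (hR : ∀ t ∈ R, p.IsRoot t)
    (hS : ∀ t ∈ S, p.IsRoot t ∧ p.derivative.IsRoot t) : R.card + S.card ≤ p.natDegree := by
  classical
  refine le_trans ?_ (Polynomial.card_roots' p)
  rw [← Multiset.toFinset_sum_count_eq]
  have hR' : R ⊆ p.roots.toFinset := fun t ht => by simpa [hp] using hR t ht
  have hS' : S ⊆ p.roots.toFinset := fun t ht => by simpa [hp] using (hS t ht).1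
  have h1 : R.card + S.card ≤ ∑ t ∈ p.roots.toFinset, (1 + if t ∈ S then 1 else 0) := by
    rw [Finset.sum_add_distrib, ← Finset.card_eq_sum_ones, ← Finset.card_filter,
      Finset.filter_mem_eq_inter, Finset.inter_eq_right.2 hS']
    exact Nat.add_le_add_right (Finset.card_le_card hR') _
  refine h1.trans (Finset.sum_le_sum fun t ht => ?_)
  rw [Polynomial.count_roots]
  split_ifs with h
  · exact (Polynomial.one_lt_rootMultiplicity_iff_isRoot hp).2 (hS t h)
  · rw [Multiset.mem_toFinset, Polynomial.mem_roots hp] at ht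
    exact (Polynomial.rootMultiplicity_pos hp).2 ht

/-- Bézout on a line. The point `w` off the curve is put at infinity: the restriction of `f` then
has leading coefficient `f(w) ≠ 0`, and all points of the curve on `l` have a finite parameter. -/
theorem secantCount_add_card_le {f : MvPolynomial (Fin 3) F} {d : ℕ} (hf : f.IsHomogeneous d)
    {l w : PP F} (hwl : w ∈ l) (hw : ¬ VanishesAt f w) (T : Finset (PP F))
    (hT : ∀ x ∈ T, VanishesAt f x ∧ x ∈ l ∧ IsTangentLine f x l) :
    secantCount (curvePoints f) l + T.card ≤ d := by
  classical
  obtain ⟨v, hvl, hvw⟩ := exists_mem_ne l w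
  set p := linePoly f v.rep w.rep with hpdef
  have hp : p ≠ 0 := fun h0 => hw <| by
    rw [VanishesAt, ← coeff_degree_linePoly hf v.rep w.rep, ← hpdef, h0, Polynomial.coeff_zero]
  set g : F → PP F := fun t => Projectivization.mk F _ (rep_add_smul_ne_zero hvw t) with hg
  have hroot : ∀ t, p.IsRoot t ↔ VanishesAt f (g t) := fun t => by
    rw [hg, vanishesAt_mk_iff hf, Polynomial.IsRoot, hpdef, eval_linePoly]
  set R := Finset.univ.filter fun t => p.IsRoot t with hR
  set S := Finset.univ.filter fun t => p.IsRoot t ∧ p.derivative.IsRoot t with hS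
  have h1 : secantCount (curvePoints f) l ≤ R.card := by
    refine le_trans (Finset.card_le_card fun x hx => ?_) (Finset.card_image_le (f := g))
    rw [Finset.mem_filter, mem_curvePoints] at hx
    obtain ⟨t, rfl⟩ := exists_eq_mk_add_smul hvw hvl hwl hx.2 (fun e => hw (e ▸ hx.1))
    exact Finset.mem_image.2 ⟨t, by simpa [hR] using (hroot t).2 hx.1, rfl⟩
  have h2 : T.card ≤ S.card := by
    refine le_trans (Finset.card_le_card fun x hx => ?_) (Finset.card_image_le (f := g))
    obtain ⟨hxf, hxl, hxt⟩ := hT x hx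
    obtain ⟨t, rfl⟩ := exists_eq_mk_add_smul hvw hvl hwl hxl (fun e => hw (e ▸ hxf))
    refine Finset.mem_image.2 ⟨t, ?_, rfl⟩
    rw [hS, Finset.mem_filter]
    refine ⟨Finset.mem_univ _, (hroot t).2 hxf, ?_⟩
    rw [Polynomial.IsRoot, hpdef, derivative_linePoly, eval_linePoly, aeval_dirDeriv,
      ← dotProduct_grad_mk hf (rep_add_smul_ne_zero hvw t)]
    exact hxt w hwl
  have h3 := card_roots_add_card_le hp (R := R) (S := S) (fun t ht => by simpa [hR] using ht)
    (fun t ht => by simpa [hS] using ht)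
  exact (Nat.add_le_add h1 h2).trans (h3.trans (natDegree_linePoly_le hf _ _))

/-- If the gradient vanishes, any line through `x` will do; otherwise the gradient is the line, and
Euler's identity puts `x` on it. -/
theorem exists_tangentLine (f : MvPolynomial (Fin 3) F) {d : ℕ} (hf : f.IsHomogeneous d)
    {x : PP F} (hx : VanishesAt f x) : ∃ l : PP F, x ∈ l ∧ IsTangentLine f x l := by
  classical
  by_cases h : grad f x.rep = 0
  · have hpos : 0 < (Finset.univ.filter fun l : PP F => x ∈ l).card := by
      rw [card_lines_through]
      omega
    obtain ⟨l, hl⟩ := Finset.card_pos.1 hpos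
    exact ⟨l, by simpa using hl, fun y _ => by rw [h, dotProduct_zero]⟩
  · refine ⟨Projectivization.mk F _ h, ?_, fun y hy => (mem_mk_iff h y).1 hy⟩
    rw [mem_mk_iff, dotProduct_grad_self hf, show aeval x.rep f = 0 from hx, mul_zero]

theorem aeval_zero_of_isHomogeneous {f : MvPolynomial (Fin 3) F} {d : ℕ} (hf : f.IsHomogeneous d)
    (hd : 0 < d) : aeval (0 : Fin 3 → F) f = 0 := by
  rw [← zero_smul F (0 : Fin 3 → F), aeval_smul_of_isHomogeneous hf, zero_pow hd.ne', zero_mul]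

theorem aeval_eq_zero_of_vanishesAt_line {f : MvPolynomial (Fin 3) F} {d : ℕ}
    (hf : f.IsHomogeneous d) (hd : 0 < d) {l : PP F} (h : ∀ w ∈ l, VanishesAt f w)
    {x : Fin 3 → F} (hx : x ⬝ᵥ l.rep = 0) : aeval x f = 0 := by
  rcases eq_or_ne x 0 with rfl | h0
  · exact aeval_zero_of_isHomogeneous hf hd
  · exact (vanishesAt_mk_iff hf x h0).1 (h _ ((mk_mem_iff h0 l).2 hx))

theorem mk_cardinal_eq : Cardinal.mk F = (Fintype.card F : Cardinal) := Cardinal.mk_fintype F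

/-- A form of degree at most `q` that vanishes at all the rational points of a line is divisible
by the equation of the line. -/
theorem linForm_dvd_of_vanishesAt {f : MvPolynomial (Fin 3) F} {d : ℕ} (hf : f.IsHomogeneous d)
    (hd : 0 < d) (hdq : d ≤ Fintype.card F) {l : PP F} (h : ∀ w ∈ l, VanishesAt f w) :
    linForm l.rep ∣ f := by
  obtain ⟨i, hi⟩ := Function.ne_iff.1 l.rep_nonzero
  set a := l.rep with ha
  set u : Fin 3 → F := Pi.single i (a i)⁻¹ with hu
  have hua : u ⬝ᵥ a = 1 := by
    rw [hu, single_dotProduct, inv_mul_cancel₀ hi]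
  -- The substitution `ψ` is the projection along `u` onto the plane over the line. The composite of
  -- `f` with it vanishes at all rational vectors, hence identically because `d ≤ q`.
  set ψ : Fin 3 → MvPolynomial (Fin 3) F := fun j => X j - C (u j) * linForm a with hψ
  have hψh : ∀ j, (ψ j).IsHomogeneous 1 := fun j =>
    (isHomogeneous_X F j).sub ((linForm_isHomogeneous a).C_mul _)
  have hzero : aeval ψ f = 0 := by
    refine IsHomogeneous.eq_zero_of_forall_eval_eq_zero_of_le_card (hf.aeval ψ hψh) (fun r => ?_)
      (by rw [one_mul, mk_cardinal_eq]; exact_mod_cast hdq)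
    rw [← MvPolynomial.coe_aeval_eq_eval]
    have h1 := MvPolynomial.comp_aeval_apply ψ (MvPolynomial.aeval r) f
    have h2 : (fun j => aeval r (ψ j)) = r - (r ⬝ᵥ a) • u := by
      funext j
      simp only [hψ, map_sub, aeval_X, map_mul, aeval_C, aeval_linForm_self, Pi.sub_apply,
        Pi.smul_apply, smul_eq_mul, Algebra.algebraMap_self, RingHom.id_apply]
      ring
    refine h1.trans ?_
    rw [h2]
    refine aeval_eq_zero_of_vanishesAt_line hf hd h ?_
    rw [sub_dotProduct, smul_dotProduct, hua, smul_eq_mul, mul_one, sub_self]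
  rw [← Ideal.mem_span_singleton, ← Ideal.Quotient.eq_zero_iff_mem]
  -- Modulo the linear form the projection is the identity, so `f` is congruent to its zero
  -- composite.
  have hcomp : (Ideal.Quotient.mkₐ F (Ideal.span {linForm a})).comp (aeval ψ)
      = Ideal.Quotient.mkₐ F (Ideal.span {linForm a}) := by
    refine MvPolynomial.algHom_ext fun j => ?_
    rw [AlgHom.comp_apply, aeval_X, Ideal.Quotient.mkₐ_eq_mk, Ideal.Quotient.eq, hψ,
      sub_sub_cancel_left, neg_mem_iff]
    exact Ideal.mul_mem_left _ _ (Ideal.mem_span_singleton_self _)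
  have h3 := DFunLike.congr_fun hcomp f
  rw [AlgHom.comp_apply, hzero, map_zero] at h3
  exact h3.symm

/-- `f` has no linear factor over the ground field. -/
def HasNoLine (f : MvPolynomial (Fin 3) F) : Prop := ∀ l : PP F, ¬ linForm l.rep ∣ f

theorem HasNoLine.exists_not_vanishesAt {f : MvPolynomial (Fin 3) F} {d : ℕ} (h : HasNoLine f)
    (hf : f.IsHomogeneous d) (hd : 0 < d) (hdq : d ≤ Fintype.card F) (l : PP F) :
    ∃ w ∈ l, ¬ VanishesAt f w := by
  by_contra hcon
  push Not at hcon
  exact h l (linForm_dvd_of_vanishesAt hf hd hdq hcon)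

theorem isTangentChoice_curvePoints {f : MvPolynomial (Fin 3) F} {d : ℕ} (h : HasNoLine f)
    (hf : f.IsHomogeneous d) (hd : 0 < d) (hdq : d ≤ Fintype.card F) {t : PP F → PP F}
    (ht : ∀ x, VanishesAt f x → x ∈ t x ∧ IsTangentLine f x (t x)) :
    IsTangentChoice (curvePoints f) t d := by
  classical
  refine ⟨fun x hx => (ht x (mem_curvePoints.1 hx)).1, fun l => ?_⟩
  obtain ⟨w, hwl, hw⟩ := h.exists_not_vanishesAt hf hd hdq l
  refine secantCount_add_card_le hf hwl hw _ fun x hx => ?_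
  rw [Finset.mem_filter, mem_curvePoints] at hx
  obtain ⟨hx, rfl⟩ := hx
  exact ⟨hx, ht x hx⟩

theorem exists_tangentChoice {f : MvPolynomial (Fin 3) F} {d : ℕ} (hf : f.IsHomogeneous d) :
    ∃ t : PP F → PP F, ∀ x, VanishesAt f x → x ∈ t x ∧ IsTangentLine f x (t x) := by
  have h : ∀ x : PP F, ∃ l, VanishesAt f x → x ∈ l ∧ IsTangentLine f x l := fun x => by
    by_cases hx : VanishesAt f x
    · obtain ⟨l, hl⟩ := exists_tangentLine f hf hx
      exact ⟨l, fun _ => hl⟩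
    -- Off the curve the value is irrelevant; `x` itself is available because `PP F` serves as the
    -- type of lines as well as of points.
    · exact ⟨x, fun h => absurd h hx⟩
  choose t ht using h
  exact ⟨t, ht⟩

theorem numPoints_le_two {f : MvPolynomial (Fin 3) F} (h : HasNoLine f)
    (hf : f.IsHomogeneous 2) (hq : 2 ≤ Fintype.card F) : numPoints f ≤ Fintype.card F + 1 := by
  classical
  obtain ⟨t, ht⟩ := exists_tangentChoice hf
  rw [numPoints_eq, ← order_PP]
  exact (isTangentChoice_curvePoints h hf (by norm_num) hq ht).card_le_two

theorem numPoints_le_three {f : MvPolynomial (Fin 3) F} (h : HasNoLine f)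
    (hf : f.IsHomogeneous 3) (hq : 3 ≤ Fintype.card F) : numPoints f ≤ 2 * Fintype.card F + 1 := by
  classical
  obtain ⟨t, ht⟩ := exists_tangentChoice hf
  rw [numPoints_eq, ← order_PP]
  exact (isTangentChoice_curvePoints h hf (by norm_num) hq ht).card_le_three

theorem numPoints_le_five {f : MvPolynomial (Fin 3) F} (h : HasNoLine f)
    (hf : f.IsHomogeneous 5) (hq : 5 ≤ Fintype.card F) : numPoints f ≤ 4 * Fintype.card F + 2 := by
  classical
  obtain ⟨t, ht⟩ := exists_tangentChoice hf
  rw [numPoints_eq, ← order_PP]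
  exact (isTangentChoice_curvePoints h hf (by norm_num) hq ht).card_le_five

end Finite

end PlaneQuintics

/-! ### Quartics: excluding `3q + 2` points -/

namespace PlaneQuintics

open MvPolynomial Configuration Configuration.ProjectivePlane Configuration.ofField

section Quartic

set_option linter.unusedSectionVars false

variable {F : Type*} [Field F] [Fintype F]

theorem dotProduct_eq_zero_of_mem {l v w : PP F} (hvw : v ≠ w) (hv : v ∈ l) (hw : w ∈ l)
    {b : Fin 3 → F} (hvb : v.rep ⬝ᵥ b = 0) (hwb : w.rep ⬝ᵥ b = 0) {y : PP F} (hy : y ∈ l) :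
    y.rep ⬝ᵥ b = 0 := by
  rw [mem_line_iff] at hv hw hy
  obtain ⟨s, t, h⟩ := exists_combination l.rep_nonzero (linearIndependent_rep hvw) hv hw hy
  rw [h, add_dotProduct, smul_dotProduct, smul_dotProduct, hvb, hwb, smul_zero, smul_zero, add_zero]

theorem mk_eq_of_forall_mem {l : PP F} {b : Fin 3 → F} (hb : b ≠ 0)
    (h : ∀ y ∈ l, y.rep ⬝ᵥ b = 0) : Projectivization.mk F b hb = l := by
  obtain ⟨v, hv, -⟩ := exists_mem_ne l l
  obtain ⟨w, hw, hwv⟩ := exists_mem_ne l v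
  exact (Nondegenerate.eq_or_eq ((mem_mk_iff hb w).2 (h w hw)) ((mem_mk_iff hb v).2 (h v hv))
    hw hv).resolve_left hwv

theorem secantCount_le {g : MvPolynomial (Fin 3) F} {e : ℕ} (hg : g.IsHomogeneous e)
    {l w : PP F} (hwl : w ∈ l) (hw : ¬ VanishesAt g w) : secantCount (curvePoints g) l ≤ e := by
  simpa using secantCount_add_card_le hg hwl hw ∅ (by simp)

/-- By its degree `p` is a constant times the square of `(X - a) (X - b)`, and squares have
derivative zero in characteristic two. -/
theorem derivative_eq_zero_of_double_roots {K : Type*} [Field K] (h2 : (2 : K) = 0)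
    {p : Polynomial K} (hp : p ≠ 0) (hdeg : p.natDegree ≤ 4) {a b : K} (hab : a ≠ b)
    (ha : p.IsRoot a ∧ p.derivative.IsRoot a) (hb : p.IsRoot b ∧ p.derivative.IsRoot b) :
    p.derivative = 0 := by
  have hdiv : ∀ c, p.IsRoot c ∧ p.derivative.IsRoot c → (Polynomial.X - Polynomial.C c) ^ 2 ∣ p :=
    fun c hc => (Polynomial.le_rootMultiplicity_iff hp).1
      ((Polynomial.one_lt_rootMultiplicity_iff_isRoot hp).2 hc)
  have hcop : IsCoprime ((Polynomial.X - Polynomial.C a) ^ 2)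
      ((Polynomial.X - Polynomial.C b) ^ 2) :=
    (Polynomial.isCoprime_X_sub_C_of_isUnit_sub (sub_ne_zero.2 hab).isUnit).pow
  obtain ⟨r, hr⟩ := hcop.mul_dvd (hdiv a ha) (hdiv b hb)
  rw [← mul_pow] at hr
  set s := (Polynomial.X - Polynomial.C a) * (Polynomial.X - Polynomial.C b) with hs
  have hsm : s.Monic := (Polynomial.monic_X_sub_C a).mul (Polynomial.monic_X_sub_C b)
  have hr0 : r.natDegree = 0 := by
    have h1 : r ≠ 0 := by
      rintro rfl
      exact hp (by rw [hr, mul_zero])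
    have h3 : s.natDegree = 2 := by
      rw [hs, Polynomial.natDegree_mul (Polynomial.X_sub_C_ne_zero a)
        (Polynomial.X_sub_C_ne_zero b), Polynomial.natDegree_X_sub_C,
        Polynomial.natDegree_X_sub_C]
    rw [hr, (hsm.pow 2).natDegree_mul' h1, hsm.natDegree_pow, h3] at hdeg
    omega
  obtain ⟨c, rfl⟩ := Polynomial.natDegree_eq_zero.1 hr0
  rw [hr, Polynomial.derivative_mul, Polynomial.derivative_C, mul_zero, add_zero,
    Polynomial.derivative_sq, h2, Polynomial.C_0, zero_mul, zero_mul, zero_mul]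

theorem dotProduct_grad_self_of_two_eq_zero (h2 : (2 : F) = 0) {f : MvPolynomial (Fin 3) F}
    (hf : f.IsHomogeneous 4) (x : Fin 3 → F) : x ⬝ᵥ grad f x = 0 := by
  rw [dotProduct_grad_self hf, show ((4 : ℕ) : F) = 2 * 2 by norm_num, h2, zero_mul, zero_mul]

/-- The vanishing derivative handles the direction `w`. Euler's identity, whose right side `4 f` is
zero here, then handles `v`. -/
theorem dotProduct_grad_of_derivative_eq_zero (h2 : (2 : F) = 0) {f : MvPolynomial (Fin 3) F}
    (hf : f.IsHomogeneous 4) {v w : Fin 3 → F} (h : (linePoly f v w).derivative = 0) (t : F) :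
    w ⬝ᵥ grad f (v + t • w) = 0 ∧ v ⬝ᵥ grad f (v + t • w) = 0 := by
  have h1 : w ⬝ᵥ grad f (v + t • w) = 0 := by
    rw [← aeval_dirDeriv, ← eval_linePoly, ← derivative_linePoly, h, Polynomial.eval_zero]
  refine ⟨h1, ?_⟩
  have h3 := dotProduct_grad_self_of_two_eq_zero h2 hf (v + t • w)
  rwa [add_dotProduct, smul_dotProduct, h1, smul_zero, add_zero] at h3

/-- In characteristic two the gradient of a quartic is conormal to a bitangent all along it. -/
theorem dotProduct_grad_of_bitangent (h2 : (2 : F) = 0) (hq : 4 ≤ Fintype.card F)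
    {f : MvPolynomial (Fin 3) F} (hf : f.IsHomogeneous 4) {l w x x' : PP F} (hwl : w ∈ l)
    (hw : ¬ VanishesAt f w) (hxx : x ≠ x') (hx : VanishesAt f x ∧ x ∈ l ∧ IsTangentLine f x l)
    (hx' : VanishesAt f x' ∧ x' ∈ l ∧ IsTangentLine f x' l) {y : PP F} (hy : y ∈ l) :
    IsTangentLine f y l := by
  obtain ⟨v, hvl, hvw⟩ := exists_mem_ne l w
  set p := linePoly f v.rep w.rep with hpdef
  have hp : p ≠ 0 := fun h0 => hw <| by
    rw [VanishesAt, ← coeff_degree_linePoly hf v.rep w.rep, ← hpdef, h0, Polynomial.coeff_zero]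
  have hroot : ∀ z, VanishesAt f z ∧ z ∈ l ∧ IsTangentLine f z l →
      ∃ t, z = Projectivization.mk F _ (rep_add_smul_ne_zero hvw t) ∧
        (p.IsRoot t ∧ p.derivative.IsRoot t) := by
    rintro z ⟨hz, hzl, hzt⟩
    obtain ⟨t, rfl⟩ := exists_eq_mk_add_smul hvw hvl hwl hzl (fun e => hw (e ▸ hz))
    refine ⟨t, rfl, ?_, ?_⟩
    · rw [vanishesAt_mk_iff hf] at hz
      rwa [Polynomial.IsRoot, hpdef, eval_linePoly]
    · rw [Polynomial.IsRoot, hpdef, derivative_linePoly, eval_linePoly, aeval_dirDeriv,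
        ← dotProduct_grad_mk hf (rep_add_smul_ne_zero hvw t)]
      exact hzt w hwl
  obtain ⟨a, rfl, ha⟩ := hroot x hx
  obtain ⟨b, rfl, hb⟩ := hroot x' hx'
  have hab : a ≠ b := fun e => hxx (by rw [e])
  have hder := derivative_eq_zero_of_double_roots h2 hp (natDegree_linePoly_le hf _ _) hab ha hb
  have hline := dotProduct_grad_of_derivative_eq_zero h2 hf hder
  intro z hz
  rcases eq_or_ne y w with rfl | hyw
  · refine dotProduct_eq_zero_of_mem hvw hvl hwl ?_
      (dotProduct_grad_self_of_two_eq_zero h2 hf _) hz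
    rw [← aeval_dirDeriv,
      ← coeff_degree_linePoly (dirDeriv_isHomogeneous hf v.rep) v.rep y.rep]
    -- The point at infinity is reached through the leading coefficient: the polynomial has degree
    -- at most three and vanishes on all of `F`, which has at least four elements.
    have hzero : linePoly (dirDeriv v.rep f) v.rep y.rep = 0 := by
      refine Polynomial.eq_zero_of_natDegree_lt_card_of_eval_eq_zero _ (f := id)
        Function.injective_id (fun t => ?_) ?_
      · rw [eval_linePoly, aeval_dirDeriv]
        exact (hline t).2
      · have := natDegree_linePoly_le (dirDeriv_isHomogeneous hf v.rep) v.rep y.rep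
        omega
    rw [hzero, Polynomial.coeff_zero]
  · obtain ⟨t, rfl⟩ := exists_eq_mk_add_smul hvw hvl hwl hy hyw
    refine dotProduct_eq_zero_of_mem hvw hvl hwl ?_ ?_ hz
    · rw [dotProduct_grad_mk hf]
      exact (hline t).2
    · rw [dotProduct_grad_mk hf]
      exact (hline t).1

/-- In characteristic two, a line through a point `V` off a quartic at which the gradient vanishes is
tangent to the quartic at all of their common points, as soon as the derivative in the direction of
`V` vanishes at one other point of the line. -/
theorem isTangentLine_of_grad_eq_zero (h2 : (2 : F) = 0) {f : MvPolynomial (Fin 3) F}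
    (hf : f.IsHomogeneous 4) {l V W : PP F} (hV : V ∈ l) (hW : W ∈ l) (hWV : W ≠ V)
    (hVf : ¬ VanishesAt f V) (hgV : grad f V.rep = 0) (hgW : V.rep ⬝ᵥ grad f W.rep = 0) {x : PP F}
    (hx : x ∈ l) (hxf : VanishesAt f x) : IsTangentLine f x l := by
  have hder : (linePoly f W.rep V.rep).derivative = 0 := by
    ext n
    rw [Polynomial.coeff_derivative, Polynomial.coeff_zero]
    -- Only the coefficients of degree one and three contribute to the derivative. The first is the
    -- derivative at `W` in direction `V`; the other, by reversal, is the derivative at `V` in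
    -- direction `W`.
    rcases n with _ | _ | _ | _ | n
    · rw [zero_add, coeff_one_linePoly, hgW, zero_mul]
    · rw [show (((0 + 1 : ℕ) : F) + 1) = 2 by norm_num, h2, mul_zero]
    · rw [coeff_linePoly hf _ _ (by norm_num)]
      norm_num
      left
      rw [coeff_one_linePoly, hgV, dotProduct_zero]
    · rw [show (((0 + 1 + 1 + 1 : ℕ) : F) + 1) = 2 * 2 by norm_num, h2, mul_zero, mul_zero]
    · rw [Polynomial.coeff_eq_zero_of_natDegree_lt, zero_mul]
      have := natDegree_linePoly_le hf W.rep V.rep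
      omega
  obtain ⟨t, rfl⟩ := exists_eq_mk_add_smul hWV hW hV hx (fun e => hVf (e ▸ hxf))
  have h := dotProduct_grad_of_derivative_eq_zero h2 hf hder t
  intro z hz
  refine dotProduct_eq_zero_of_mem hWV hW hV ?_ ?_ hz
  · rw [dotProduct_grad_mk hf]
    exact h.2
  · rw [dotProduct_grad_mk hf]
    exact h.1

theorem two_eq_zero_of_even_card (h : Even (Fintype.card F)) : (2 : F) = 0 := by
  have h1 : ringChar F = 2 :=
    FiniteField.even_card_iff_char_two.2 (Nat.even_iff.1 h)
  have h3 := ringChar.Nat.cast_ringChar (R := F)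
  rw [h1] at h3
  exact_mod_cast h3

theorem numPoints_le_four {f : MvPolynomial (Fin 3) F} (h : HasNoLine f)
    (hf : f.IsHomogeneous 4) (hq : 5 ≤ Fintype.card F) : numPoints f ≤ 3 * Fintype.card F + 1 := by
  classical
  obtain ⟨t, ht⟩ := exists_tangentChoice hf
  have htc := isTangentChoice_curvePoints h hf (by norm_num) (by omega) ht
  rw [numPoints_eq]
  rcases htc.card_le_four with hle | ⟨hcard, hstr⟩
  · rwa [order_PP] at hle
  exfalso
  rw [order_PP] at hcard
  set C := curvePoints f with hC
  set B := C.image t with hB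
  have hmemC : ∀ x, x ∈ C ↔ VanishesAt f x := fun x => mem_curvePoints
  -- In the extremal case every chosen tangent is chosen by exactly two points, so `3q + 2` is even.
  have hBcard : C.card = B.card * 2 := by
    rw [Finset.card_eq_sum_card_fiberwise (f := t) (t := B)
      (fun x hx => Finset.mem_coe.2 (Finset.mem_image_of_mem _ hx)), ← smul_eq_mul,
      ← Finset.sum_const]
    refine Finset.sum_congr rfl fun l hl => ?_
    obtain ⟨x, hx, rfl⟩ := Finset.mem_image.1 hl
    have := (hstr x hx).2.1
    unfold tangentCount at this
    convert this
  have h2 : (2 : F) = 0 := two_eq_zero_of_even_card <| by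
    rw [Nat.even_iff]
    omega
  -- At a singular point any line counts double, but the lines through `x` other than `t x` already
  -- contain four points.
  have hsmooth : ∀ x ∈ C, grad f x.rep ≠ 0 := by
    intro x hx h0
    obtain ⟨l, hl, hne⟩ : ∃ l : PP F, x ∈ l ∧ l ≠ t x := by
      obtain ⟨l, hl, hne⟩ := exists_mem_ne x (t x)
      exact ⟨l, Projectivization.orthogonal_comm.1 hl, hne⟩
    obtain ⟨w, hwl, hw⟩ := h.exists_not_vanishesAt hf (by norm_num) (by omega) l
    have h3 := secantCount_add_card_le hf hwl hw {x} (fun y hy => by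
      rw [Finset.mem_singleton] at hy
      subst hy
      exact ⟨(hmemC y).1 hx, hl, fun z _ => by rw [h0, dotProduct_zero]⟩)
    rw [(hstr x hx).2.2 l hl hne, Finset.card_singleton] at h3
    omega
  have hconormal : ∀ l ∈ B, ∀ y ∈ l, IsTangentLine f y l := by
    intro l hl y hy
    obtain ⟨x, hx, rfl⟩ := Finset.mem_image.1 hl
    obtain ⟨w, hwl, hw⟩ := h.exists_not_vanishesAt hf (by norm_num) (by omega) (t x)
    have h3 := (hstr x hx).2.1
    unfold tangentCount at h3
    obtain ⟨x1, hx1, x2, hx2, hne⟩ := Finset.one_lt_card.1 (by rw [h3]; norm_num)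
    rw [Finset.mem_filter] at hx1 hx2
    refine dotProduct_grad_of_bitangent h2 (by omega) hf hwl hw hne ?_ ?_ hy
    · exact ⟨(hmemC _).1 hx1.1, hx1.2 ▸ ht x1 ((hmemC _).1 hx1.1)⟩
    · exact ⟨(hmemC _).1 hx2.1, hx2.2 ▸ ht x2 ((hmemC _).1 hx2.1)⟩
  -- A nonzero gradient would be conormal to two different lines.
  have hmeet : ∀ l ∈ B, ∀ m ∈ B, l ≠ m → ∀ V, V ∈ l → V ∈ m → grad f V.rep = 0 := by
    intro l hl m hm hlm V hVl hVm
    by_contra h0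
    exact hlm ((mk_eq_of_forall_mem h0 (hconormal l hl V hVl)).symm.trans
      (mk_eq_of_forall_mem h0 (hconormal m hm V hVm)))
  -- The derivative of `f` in a direction `u` off `l` is a cubic vanishing where the gradient does.
  -- It is not zero along `l`: at a point of `C` on `l` the gradient is nonzero and conormal to `l`,
  -- which does not contain `u`.
  have hon : ∀ l ∈ B, (Finset.univ.filter fun V : PP F => V ∈ l ∧ grad f V.rep = 0).card ≤ 3 := by
    intro l hl
    obtain ⟨u, hu⟩ := Nondegenerate.exists_point (P := PP F) l
    have hg := dirDeriv_isHomogeneous hf u.rep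
    by_cases hw : ∃ w ∈ l, ¬ VanishesAt (dirDeriv u.rep f) w
    · obtain ⟨w, hwl, hw⟩ := hw
      refine le_trans (Finset.card_le_card fun V hV => ?_) (secantCount_le hg hwl hw)
      simp only [Finset.mem_filter, Finset.mem_univ, true_and] at hV
      rw [Finset.mem_filter, mem_curvePoints, VanishesAt, aeval_dirDeriv, hV.2, dotProduct_zero]
      exact ⟨rfl, hV.1⟩
    · push Not at hw
      obtain ⟨x, hx, rfl⟩ := Finset.mem_image.1 hl
      exfalso
      have hxl := htc.mem x hx
      have h4 := mk_eq_of_forall_mem (hsmooth x hx) (hconormal _ hl x hxl)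
      refine hu ?_
      rw [← h4, mem_mk_iff, ← aeval_dirDeriv]
      exact hw x hxl
  -- The bitangents through `V` cut a line `m` off `V` in distinct points, all of them zeros of the
  -- cubic derivative in direction `V`.
  have hthrough : ∀ V : PP F, grad f V.rep = 0 → (B.filter (V ∈ ·)).card ≤ 3 := by
    intro V hV
    have hVC : V ∉ C := fun hVC => hsmooth V hVC hV
    obtain ⟨m, hm⟩ := Nondegenerate.exists_line (L := PP F) V
    have hg := dirDeriv_isHomogeneous hf V.rep
    have hmk : ∀ l : PP F, V ∈ l → ∃ W, W ∈ l ∧ W ∈ m ∧ W ≠ V := fun l hl => by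
      have hlm : l ≠ m := fun e => hm (e ▸ hl)
      have h5 := HasPoints.mkPoint_ax (P := PP F) hlm
      exact ⟨_, h5.1, h5.2, fun e => hm (e ▸ h5.2)⟩
    by_cases hw : ∃ w ∈ m, ¬ VanishesAt (dirDeriv V.rep f) w
    · obtain ⟨w, hwm, hw⟩ := hw
      refine le_trans ?_ (secantCount_le hg hwm hw)
      have hW : ∀ l : PP F, ∃ W, V ∈ l → W ∈ l ∧ W ∈ m ∧ W ≠ V := fun l => by
        by_cases hl : V ∈ l
        · obtain ⟨W, hW⟩ := hmk l hl
          exact ⟨W, fun _ => hW⟩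
        · exact ⟨V, fun h => absurd h hl⟩
      choose W hW using hW
      refine Finset.card_le_card_of_injOn W (fun l hl => ?_) (fun l hl l' hl' e => ?_)
      · rw [Finset.mem_coe, Finset.mem_filter] at hl
        obtain ⟨h5, h6, -⟩ := hW l hl.2
        rw [Finset.mem_coe, Finset.mem_filter, mem_curvePoints, VanishesAt, aeval_dirDeriv]
        exact ⟨hconormal l hl.1 _ h5 V hl.2, h6⟩
      · rw [Finset.mem_coe, Finset.mem_filter] at hl hl'
        obtain ⟨h5, -, h6⟩ := hW l hl.2
        obtain ⟨h7, -, -⟩ := hW l' hl'.2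
        rw [← e] at h7
        exact (Nondegenerate.eq_or_eq h5 hl.2 h7 hl'.2).resolve_left h6
    -- If that cubic is zero all along `m`, every line through `V` is tangent at all its points of
    -- `C` and so has at most two of them. Then `|C| ≤ 2 (q + 1) < 3q + 2`.
    · push Not at hw
      exfalso
      have hle : ∀ l : PP F, V ∈ l → secantCount C l ≤ 2 := fun l hl => by
        obtain ⟨W, hWl, hWm, hWV⟩ := hmk l hl
        have h5 := secantCount_add_card_le hf hl (fun e => hVC ((hmemC V).2 e))
          (C.filter (· ∈ l)) (fun x hx => by
            rw [Finset.mem_filter] at hx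
            refine ⟨(hmemC x).1 hx.1, hx.2, ?_⟩
            refine isTangentLine_of_grad_eq_zero h2 hf hl hWl hWV
              (fun e => hVC ((hmemC V).2 e)) hV ?_ hx.2 ((hmemC x).1 hx.1)
            rw [← aeval_dirDeriv]
            exact hw W hWm)
        change secantCount C l + secantCount C l ≤ 4 at h5
        omega
      have h6 := sum_secantCount (L := PP F) C V
      rw [if_neg hVC, hcard] at h6
      have h7 : ∑ l : PP F with V ∈ l, secantCount C l ≤ (Fintype.card F + 1) * 2 := by
        rw [← order_PP, ← card_lines_through V, ← smul_eq_mul, ← Finset.sum_const]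
        exact Finset.sum_le_sum fun l hl => hle l (by simpa using hl)
      omega
  have hCne : C.Nonempty := Finset.card_pos.1 (by omega)
  obtain ⟨x, hx⟩ := hCne
  have hl0 : t x ∈ B := Finset.mem_image_of_mem _ hx
  have hsub : B.erase (t x) ⊆ (Finset.univ.filter fun V : PP F =>
      V ∈ t x ∧ grad f V.rep = 0).biUnion fun V => (B.filter (V ∈ ·)).erase (t x) := by
    intro l hl
    rw [Finset.mem_erase] at hl
    have h5 := HasPoints.mkPoint_ax (P := PP F) hl.1
    refine Finset.mem_biUnion.2 ⟨HasPoints.mkPoint hl.1, ?_, ?_⟩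
    · simp only [Finset.mem_filter, Finset.mem_univ, true_and]
      exact ⟨h5.2, hmeet l hl.2 _ hl0 hl.1 _ h5.1 h5.2⟩
    · rw [Finset.mem_erase, Finset.mem_filter]
      exact ⟨hl.1, hl.2, h5.1⟩
  -- The bitangent `t x` has at most three points of zero gradient, each on at most two further
  -- bitangents. So `|B| ≤ 7` and `|C| ≤ 14`, while `3q + 2 ≥ 17`.
  have h8 := (Finset.card_le_card hsub).trans
    (Finset.card_biUnion_le_card_mul _ _ 2 fun V hV => by
      simp only [Finset.mem_filter, Finset.mem_univ, true_and] at hV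
      rw [Finset.card_erase_of_mem (by simp [hl0, hV.1])]
      have := hthrough V hV.2
      omega)
  have h9 := hon _ hl0
  rw [Finset.card_erase_of_mem hl0] at h8
  omega

end Quartic

end PlaneQuintics

/-! ### Frobenius orbits and points of degree three -/

namespace PlaneQuintics

open MvPolynomial Configuration Configuration.ProjectivePlane Configuration.ofField

section Frobenius

set_option linter.unusedSectionVars false

variable {F : Type*} [Field F] [Fintype F]

theorem vanishesAt_mul {E K : Type*} [Field E] [Field K] [Algebra E K]
    (f g : MvPolynomial (Fin 3) E) (p : PP K) :
    VanishesAt (f * g) p ↔ VanishesAt f p ∨ VanishesAt g p := by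
  simp [VanishesAt]

theorem vanishesAt_prod {E K ι : Type*} [Field E] [Field K] [Algebra E K] (s : Finset ι)
    (l : ι → MvPolynomial (Fin 3) E) (p : PP K) :
    VanishesAt (∏ i ∈ s, l i) p ↔ ∃ i ∈ s, VanishesAt (l i) p := by
  simp [VanishesAt, map_prod, Finset.prod_eq_zero_iff]

theorem aeval_frobeniusVec (f : MvPolynomial (Fin 3) F) (v : Fin 3 → AlgebraicClosure F) :
    aeval (frobeniusVec F v) f = aeval v f ^ Fintype.card F :=
  (MvPolynomial.comp_aeval_apply v
    (FiniteField.frobeniusAlgHom F (AlgebraicClosure F)) f).symm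

theorem frobeniusVec_ne_zero {v : Fin 3 → AlgebraicClosure F} (hv : v ≠ 0) :
    frobeniusVec F v ≠ 0 := fun h =>
  hv (frobeniusVec_injective F (h.trans (map_zero (frobeniusVec F)).symm))

theorem frobenius_mk {v : Fin 3 → AlgebraicClosure F} (hv : v ≠ 0) :
    frobenius F (Projectivization.mk _ v hv)
      = Projectivization.mk _ (frobeniusVec F v) (frobeniusVec_ne_zero hv) := rfl

theorem vanishesAt_frobenius {f : MvPolynomial (Fin 3) F} {d : ℕ} (hf : f.IsHomogeneous d)
    (p : GeomPP F) : VanishesAt f (frobenius F p) ↔ VanishesAt f p := by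
  induction p using Projectivization.ind with
  | h v hv =>
    rw [frobenius_mk, vanishesAt_mk_iff hf, vanishesAt_mk_iff hf, aeval_frobeniusVec,
      pow_eq_zero_iff Fintype.card_ne_zero]

theorem vanishesAt_frobenius_iterate {f : MvPolynomial (Fin 3) F} {d : ℕ} (hf : f.IsHomogeneous d)
    (p : GeomPP F) (n : ℕ) : VanishesAt f ((frobenius F)^[n] p) ↔ VanishesAt f p := by
  induction n with
  | zero => rfl
  | succ n ih => rw [Function.iterate_succ_apply', vanishesAt_frobenius hf, ih]

theorem contains_orbit_iff {f : MvPolynomial (Fin 3) F} {d : ℕ} (hf : f.IsHomogeneous d)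
    (p : GeomPP F) :
    Contains f (Set.range fun n : ℕ => (frobenius F)^[n] p) ↔ VanishesAt f p :=
  ⟨fun h => h p ⟨0, rfl⟩, by
    rintro h _ ⟨n, rfl⟩
    exact (vanishesAt_frobenius_iterate hf p n).2 h⟩

/-- The factor of proportionality of the images is a `q`-th power in the algebraic closure; its root
is a factor for the original vectors. -/
theorem frobenius_injective : Function.Injective (frobenius F) := by
  intro p r h
  induction p using Projectivization.ind with
  | h v hv =>
    induction r using Projectivization.ind with
    | h w hw =>
      rw [frobenius_mk, frobenius_mk, Projectivization.mk_eq_mk_iff'] at h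
      obtain ⟨a, ha⟩ := h
      obtain ⟨b, hb⟩ := IsAlgClosed.exists_pow_nat_eq a (n := Fintype.card F) Fintype.card_pos
      rw [Projectivization.mk_eq_mk_iff']
      refine ⟨b, frobeniusVec_injective F ?_⟩
      rw [← ha, ← hb]
      ext i
      rw [frobeniusVec_apply, Pi.smul_apply, Pi.smul_apply, frobeniusVec_apply, smul_eq_mul,
        smul_eq_mul, mul_pow]

theorem range_iterate_subset {α : Type*} {g : α → α} {x : α} {k : ℕ} (hk : 0 < k)
    (h : g^[k] x = x) :
    (Set.range fun n : ℕ => g^[n] x) ⊆ (fun n => g^[n] x) '' Set.Iio k := by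
  rintro _ ⟨n, rfl⟩
  exact ⟨n % k, Nat.mod_lt _ hk, Function.IsPeriodicPt.iterate_mod_apply h n⟩

theorem ncard_range_iterate_le {α : Type*} {g : α → α} {x : α} {k : ℕ} (hk : 0 < k)
    (h : g^[k] x = x) : (Set.range fun n : ℕ => g^[n] x).ncard ≤ k := by
  have h1 : (Set.Iio k).ncard = k := by
    rw [← Finset.coe_Iio, Set.ncard_coe_finset, Nat.card_Iio]
  exact (Set.ncard_le_ncard (range_iterate_subset hk h) ((Set.finite_Iio k).image _)).trans
    ((Set.ncard_image_le (Set.finite_Iio k)).trans h1.le)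

theorem iterate_eq_of_ncard_eq_three {α : Type*} {g : α → α} (hg : Function.Injective g) {x : α}
    (h : (Set.range fun n : ℕ => g^[n] x).ncard = 3) : g^[3] x = x := by
  have hfin : (Set.range fun n : ℕ => g^[n] x).Finite := Set.finite_of_ncard_ne_zero (by omega)
  by_contra h3
  have h1 : g^[1] x ≠ x := fun e => by
    have := ncard_range_iterate_le one_pos e
    omega
  have h2 : g^[2] x ≠ x := fun e => by
    have := ncard_range_iterate_le two_pos e
    omega
  have hinj : Set.InjOn (fun n => g^[n] x) (Finset.range 4) := by
    have key : ∀ i j : ℕ, i < j → j < 4 → g^[i] x ≠ g^[j] x := by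
      intro i j hij hj e
      obtain ⟨k, rfl⟩ := Nat.exists_eq_add_of_lt hij
      rw [add_assoc, Function.iterate_add_apply] at e
      have e' := (hg.iterate i) e
      have : k = 0 ∨ k = 1 ∨ k = 2 := by omega
      rcases this with rfl | rfl | rfl
      · exact h1 e'.symm
      · exact h2 e'.symm
      · exact h3 e'.symm
    intro i hi j hj e
    rw [Finset.mem_coe, Finset.mem_range] at hi hj
    rcases lt_trichotomy i j with hij | hij | hij
    · exact absurd e (key i j hij hj)
    · exact hij
    · exact absurd e.symm (key j i hij hi)
  have h4 := Set.ncard_le_ncard (s := (fun n => g^[n] x) '' (Finset.range 4 : Set ℕ))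
    (by rintro _ ⟨n, -, rfl⟩; exact ⟨n, rfl⟩) hfin
  rw [hinj.ncard_image, Set.ncard_coe_finset, Finset.card_range, h] at h4
  omega

/-- No line over the ground field passes through the geometric point `p`. -/
def NotOnLine (p : GeomPP F) : Prop := ∀ a : Fin 3 → F, a ≠ 0 → ¬ VanishesAt (linForm a) p

theorem NotOnLine.not_vanishesAt {p : GeomPP F} (hp : NotOnLine p) {l : MvPolynomial (Fin 3) F}
    (hl : l.IsHomogeneous 1) (hl0 : l ≠ 0) : ¬ VanishesAt l p := by
  obtain ⟨a, rfl⟩ := exists_eq_linForm hl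
  refine hp a ?_
  rintro rfl
  exact hl0 (by simp [linForm])

/-- Replaces `P` by one geometric point: a form over `F` vanishes on the whole orbit as soon as it
vanishes at `p`. -/
theorem IsNoncollinearCubicPoint.exists_point {P : Set (GeomPP F)}
    (hP : IsNoncollinearCubicPoint P) :
    ∃ p : GeomPP F, P = (Set.range fun n : ℕ => (frobenius F)^[n] p) ∧
      (frobenius F)^[3] p = p ∧ NotOnLine p := by
  obtain ⟨⟨⟨p, rfl⟩, hcard⟩, hline⟩ := hP
  refine ⟨p, rfl, iterate_eq_of_ncard_eq_three frobenius_injective hcard, fun a ha hv => ?_⟩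
  exact hline _ (isCurve_linForm ha) ((contains_orbit_iff (linForm_isHomogeneous a) p).2 hv)

/-- The polynomial `X ^ q - X` has at most `q` roots, and the elements of `F` already provide `q`.
-/
theorem exists_algebraMap_eq {K : Type*} [Field K] [Algebra F K] {x : K}
    (hx : x ^ Fintype.card F = x) : ∃ a : F, algebraMap F K a = x := by
  classical
  have hq : 1 < Fintype.card F := Fintype.one_lt_card
  set p : Polynomial K := Polynomial.X ^ Fintype.card F - Polynomial.X with hp
  have hp0 : p ≠ 0 := FiniteField.X_pow_card_sub_X_ne_zero K hq
  have hdeg : p.natDegree = Fintype.card F := FiniteField.X_pow_card_sub_X_natDegree_eq K hq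
  have hroot : ∀ y : K, y ∈ p.roots.toFinset ↔ y ^ Fintype.card F = y := by
    intro y
    rw [Multiset.mem_toFinset, Polynomial.mem_roots hp0, Polynomial.IsRoot, hp]
    simp [sub_eq_zero]
  have hsub : Finset.univ.image (algebraMap F K) ⊆ p.roots.toFinset := by
    intro y hy
    obtain ⟨a, -, rfl⟩ := Finset.mem_image.1 hy
    rw [hroot, ← map_pow, FiniteField.pow_card]
  have heq := Finset.eq_of_subset_of_card_le hsub <| by
    rw [Finset.card_image_of_injective _ (algebraMap F K).injective, Finset.card_univ, ← hdeg]
    exact (Multiset.toFinset_card_le _).trans (Polynomial.card_roots' p)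
  have hmem := (hroot x).2 hx
  rw [← heq] at hmem
  obtain ⟨a, -, ha⟩ := Finset.mem_image.1 hmem
  exact ⟨a, ha⟩

theorem exists_cube_frobenius_smul {p : GeomPP F} (hp : (frobenius F)^[3] p = p) :
    ∃ c : AlgebraicClosure F, ∀ i,
      ((p.rep i ^ Fintype.card F) ^ Fintype.card F) ^ Fintype.card F = c * p.rep i := by
  have h : (frobenius F)^[3] (Projectivization.mk _ p.rep p.rep_nonzero)
      = Projectivization.mk _ p.rep p.rep_nonzero := by rwa [p.mk_rep]
  simp only [Function.iterate_succ, Function.iterate_zero, Function.comp_apply, id_eq,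
    frobenius_mk] at h
  rw [Projectivization.mk_eq_mk_iff'] at h
  obtain ⟨c, hc⟩ := h
  exact ⟨c, fun i => (congrFun hc i).symm⟩

theorem exists_cube_aeval_linForm {p : GeomPP F} (hp : (frobenius F)^[3] p = p) :
    ∃ c : AlgebraicClosure F, ∀ a : Fin 3 → F,
      ((aeval p.rep (linForm a) ^ Fintype.card F) ^ Fintype.card F) ^ Fintype.card F
        = c * aeval p.rep (linForm a) := by
  obtain ⟨c, hc⟩ := exists_cube_frobenius_smul hp
  refine ⟨c, fun a => ?_⟩
  rw [← aeval_frobeniusVec, ← aeval_frobeniusVec, ← aeval_frobeniusVec, aeval_linForm,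
    aeval_linForm, Finset.mul_sum]
  refine Finset.sum_congr rfl fun i _ => ?_
  rw [frobeniusVec_apply, frobeniusVec_apply, frobeniusVec_apply, hc]
  ring

/-- The ratio of two independent linear forms at a noncollinear point of degree three has degree
three over the ground field. -/
theorem quadratic_eq_zero_of_vanishes {p : GeomPP F} (hp : (frobenius F)^[3] p = p)
    (hline : NotOnLine p) {a b : Fin 3 → F} (hb : b ≠ 0) (hab : ∀ s : F, a ≠ s • b) {α β γ : F}
    (h : algebraMap F (AlgebraicClosure F) α * aeval p.rep (linForm a) ^ 2
      + algebraMap F (AlgebraicClosure F) β * aeval p.rep (linForm a) * aeval p.rep (linForm b)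
      + algebraMap F (AlgebraicClosure F) γ * aeval p.rep (linForm b) ^ 2 = 0) :
    α = 0 ∧ β = 0 ∧ γ = 0 := by
  classical
  set K := AlgebraicClosure F
  set q := Fintype.card F with hqdef
  set A := aeval p.rep (linForm a) with hA
  set B := aeval p.rep (linForm b) with hB
  have hB0 : B ≠ 0 := hline b hb
  set t := A / B with ht
  obtain ⟨c, hc⟩ := exists_cube_aeval_linForm hp
  have hc0 : c ≠ 0 := by
    rintro rfl
    have h1 := hc b
    rw [zero_mul] at h1
    have hq0 : q ≠ 0 := Fintype.card_ne_zero
    rw [pow_eq_zero_iff hq0, pow_eq_zero_iff hq0, pow_eq_zero_iff hq0] at h1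
    exact hB0 h1
  -- The factor `c` is the same for all linear forms, so it cancels in the ratio.
  have ht3 : ((t ^ q) ^ q) ^ q = t := by
    rw [ht, div_pow, div_pow, div_pow, hc a, hc b, mul_div_mul_left _ _ hc0]
  -- If `t` were an element `s` of `F`, the rational line `a - s b` would pass through `p`.
  have hfix : t ^ q ≠ t := by
    intro e
    obtain ⟨s, hs⟩ := exists_algebraMap_eq e
    refine hline (a - s • b) (sub_ne_zero.2 (hab s)) ?_
    have h1 : A = algebraMap F K s * B := by rw [hs, ht, div_mul_cancel₀ _ hB0]
    rw [VanishesAt, aeval_linForm]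
    rw [hA, hB, aeval_linForm, aeval_linForm, Finset.mul_sum] at h1
    rw [← sub_eq_zero.2 h1, ← Finset.sum_sub_distrib]
    refine Finset.sum_congr rfl fun i _ => ?_
    rw [Pi.sub_apply, Pi.smul_apply, smul_eq_mul, map_sub, map_mul]
    ring
  have hinj : Function.Injective fun x : K => x ^ q :=
    (FiniteField.frobeniusAlgHom F K).toRingHom.injective
  have h12 : t ^ q ≠ (t ^ q) ^ q := fun e => hfix (hinj e).symm
  have h02 : t ≠ (t ^ q) ^ q := fun e => hfix (by
    conv_lhs => rw [e]
    exact ht3)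
  set P : Polynomial F := Polynomial.C α * Polynomial.X ^ 2 + Polynomial.C β * Polynomial.X
    + Polynomial.C γ with hP
  have hroot : Polynomial.aeval t P = 0 := by
    simp only [hP, map_add, map_mul, map_pow, Polynomial.aeval_C, Polynomial.aeval_X]
    rw [ht]
    field_simp
    linear_combination h
  have hrootq : ∀ x : K, Polynomial.aeval x P = 0 → Polynomial.aeval (x ^ q) P = 0 := by
    intro x hx
    have h1 := Polynomial.aeval_algHom_apply (FiniteField.frobeniusAlgHom F K) x P
    rw [hx, map_zero] at h1
    exact h1
  -- The three distinct conjugates of `t` are roots of a polynomial of degree at most two.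
  have hP0 : P = 0 := by
    by_contra hne
    have hmap : P.map (algebraMap F K) ≠ 0 :=
      (Polynomial.map_ne_zero_iff (algebraMap F K).injective).2 hne
    have h3 : ({t, t ^ q, (t ^ q) ^ q} : Finset K) ⊆ (P.map (algebraMap F K)).roots.toFinset := by
      intro x hx
      rw [Multiset.mem_toFinset, Polynomial.mem_roots hmap, Polynomial.IsRoot,
        Polynomial.eval_map_algebraMap]
      simp only [Finset.mem_insert, Finset.mem_singleton] at hx
      rcases hx with rfl | rfl | rfl
      · exact hroot
      · exact hrootq _ hroot
      · exact hrootq _ (hrootq _ hroot)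
    have h4 := Finset.card_le_card h3
    rw [Finset.card_eq_three.2 ⟨t, t ^ q, (t ^ q) ^ q, Ne.symm hfix, h02, h12, rfl⟩] at h4
    have h5 := (Multiset.toFinset_card_le _).trans (Polynomial.card_roots' (P.map (algebraMap F K)))
    rw [Polynomial.natDegree_map] at h5
    have h6 : P.natDegree ≤ 2 := by
      rw [hP]
      exact Polynomial.natDegree_quadratic_le
    omega
  have e2 := congrArg (Polynomial.coeff · 2) hP0
  have e1 := congrArg (Polynomial.coeff · 1) hP0
  have e0 := congrArg (Polynomial.coeff · 0) hP0
  simp [hP, Polynomial.coeff_X, Polynomial.coeff_C] at e0 e1 e2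
  exact ⟨e2, e1, e0⟩

end Frobenius

end PlaneQuintics

/-! ### The upper bound, by splitting off rational lines -/

namespace PlaneQuintics

open MvPolynomial Configuration Configuration.ProjectivePlane Configuration.ofField

section Bound

set_option linter.unusedSectionVars false

variable {F : Type*} [Field F] [Fintype F]

theorem curvePoints_mul [DecidableEq (PP F)] (f g : MvPolynomial (Fin 3) F) :
    curvePoints (f * g) = curvePoints f ∪ curvePoints g := by
  ext x
  rw [Finset.mem_union, mem_curvePoints, mem_curvePoints, mem_curvePoints, vanishesAt_mul]

theorem card_curvePoints_linForm (l : PP F) :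
    (curvePoints (linForm l.rep)).card = Fintype.card F + 1 := by
  classical
  rw [← order_PP, ← card_points_on (P := PP F) l]
  congr 1
  ext x
  rw [mem_curvePoints, vanishesAt_linForm_rep]
  simp

theorem numPoints_le_of_hasNoLine (hq : 5 ≤ Fintype.card F) {e : ℕ} (he : 1 ≤ e) (he3 : e ≤ 3)
    {f : MvPolynomial (Fin 3) F} (hf : f.IsHomogeneous (e + 1)) (h : HasNoLine f) :
    numPoints f ≤ e * Fintype.card F + 1 := by
  interval_cases e
  · have := numPoints_le_two h hf (by omega)
    omega
  · exact numPoints_le_three h hf (by omega)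
  · exact numPoints_le_four h hf hq

/-- Induction on the degree `e + 1`. Without the point `p` the bound fails for `e + 1` concurrent
lines once `q` is given: they have `(e + 1) q + 1` points. Passing through `p` stops the descent,
since degree one is impossible. -/
theorem numPoints_le_of_vanishesAt (hq : 5 ≤ Fintype.card F) {p : GeomPP F} (hp : NotOnLine p)
    (e : ℕ) (he : e ≤ 4) (f : MvPolynomial (Fin 3) F) (hf0 : f ≠ 0) (hf : f.IsHomogeneous (e + 1))
    (hfp : VanishesAt f p) : numPoints f ≤ e * Fintype.card F + 2 := by
  classical
  induction e generalizing f with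
  | zero => exact absurd hfp (hp.not_vanishesAt hf hf0)
  | succ e ih =>
    by_cases h : HasNoLine f
    · rcases Nat.lt_or_ge e 3 with h3 | h3
      · have := numPoints_le_of_hasNoLine hq (by omega) (by omega) hf h
        omega
      · obtain rfl : e = 3 := by omega
        exact numPoints_le_five h hf hq
    · unfold HasNoLine at h
      push Not at h
      obtain ⟨l, g, rfl⟩ := h
      have hl0 : linForm l.rep ≠ 0 := linForm_ne_zero l.rep_nonzero
      have hg0 : g ≠ 0 := right_ne_zero_of_mul hf0
      have hg : g.IsHomogeneous (e + 1) :=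
        isHomogeneous_of_mul_left hl0 (linForm_isHomogeneous _) (by rwa [add_comm 1 (e + 1)])
      have hgp : VanishesAt g p :=
        ((vanishesAt_mul _ _ _).1 hfp).resolve_left (hp _ l.rep_nonzero)
      have hunion := Finset.card_union_add_card_inter (curvePoints (linForm l.rep)) (curvePoints g)
      rw [card_curvePoints_linForm, ← numPoints_eq] at hunion
      rw [numPoints_eq, curvePoints_mul]
      have hmul : (e + 1) * Fintype.card F = e * Fintype.card F + Fintype.card F := by ring
      -- If the residual curve has no line, its bound is smaller by one and no intersection with `l`
      -- is needed. If it contains a line `m`, a common rational point of `l` and `m` is counted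
      -- twice, which saves one.
      by_cases hgl : HasNoLine g
      · rcases Nat.eq_zero_or_pos e with rfl | hepos
        · exact absurd hgp (hp.not_vanishesAt hg hg0)
        · have := numPoints_le_of_hasNoLine hq hepos (by omega) hg hgl
          omega
      · unfold HasNoLine at hgl
        push Not at hgl
        obtain ⟨m, hm⟩ := hgl
        have hinter : 0 < (curvePoints (linForm l.rep) ∩ curvePoints g).card := by
          obtain ⟨R, hRl, hRm⟩ : ∃ R : PP F, R ∈ l ∧ R ∈ m := by
            by_cases hlm : l = m
            · obtain ⟨R, hR, -⟩ := exists_mem_ne l l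
              exact ⟨R, hR, hlm ▸ hR⟩
            · exact ⟨_, HasPoints.mkPoint_ax hlm⟩
          refine Finset.card_pos.2 ⟨R, Finset.mem_inter.2 ⟨?_, ?_⟩⟩
          · rwa [mem_curvePoints, vanishesAt_linForm_rep]
          · obtain ⟨k, rfl⟩ := hm
            rw [mem_curvePoints, vanishesAt_mul, vanishesAt_linForm_rep]
            exact Or.inl hRm
        have := ih (by omega) g hg0 hg hgp
        omega

end Bound

/-! ### Conics through a point of degree three -/

section Conic

set_option linter.unusedSectionVars false

variable {F : Type*} [Field F]

theorem aeval_add_smul_of_quadratic {c : MvPolynomial (Fin 3) F} (hc : c.IsHomogeneous 2)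
    (x y : Fin 3 → F) (t : F) :
    aeval (x + t • y) c = aeval x c + t * (y ⬝ᵥ grad c x) + t ^ 2 * aeval y c := by
  rw [← eval_linePoly, Polynomial.eval_eq_sum_range' (n := 3)
    (Nat.lt_succ_of_le (natDegree_linePoly_le hc x y)), Finset.sum_range_succ,
    Finset.sum_range_succ, Finset.sum_range_one, coeff_zero_linePoly, coeff_one_linePoly,
    coeff_degree_linePoly hc]
  ring

/-- The polar form is symmetric in every characteristic, by the two expansions of `c(x + y)`. -/
theorem dotProduct_grad_comm {c : MvPolynomial (Fin 3) F} (hc : c.IsHomogeneous 2)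
    (x y : Fin 3 → F) : y ⬝ᵥ grad c x = x ⬝ᵥ grad c y := by
  have h1 := aeval_add_smul_of_quadratic hc x y 1
  have h2 := aeval_add_smul_of_quadratic hc y x 1
  rw [one_smul] at h1 h2
  rw [add_comm y x, h1] at h2
  linear_combination h2

variable [Fintype F]

theorem irreducible_of_conic {p : GeomPP F} (hp : NotOnLine p) {c : MvPolynomial (Fin 3) F}
    (hc : IsCurve 2 c) (hcp : VanishesAt c p) : Irreducible c := by
  refine irreducible_of_forall_ne_mul hc.2 hc.1 two_pos ?_
  rintro m n A B hm hn hmn hA hB rfl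
  obtain rfl : m = 1 := by omega
  obtain rfl : n = 1 := by omega
  rcases (vanishesAt_mul _ _ _).1 hcp with h | h
  · exact hp.not_vanishesAt hA (left_ne_zero_of_mul hc.1) h
  · exact hp.not_vanishesAt hB (right_ne_zero_of_mul hc.1) h

theorem hasNoLine_of_conic {p : GeomPP F} (hp : NotOnLine p) {c : MvPolynomial (Fin 3) F}
    (hc : IsCurve 2 c) (hcp : VanishesAt c p) : HasNoLine c := by
  rintro l ⟨g, rfl⟩
  have hg : g.IsHomogeneous 1 := isHomogeneous_of_mul_left (left_ne_zero_of_mul hc.1)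
    (linForm_isHomogeneous _) hc.2
  rcases (vanishesAt_mul _ _ _).1 hcp with h | h
  · exact hp _ l.rep_nonzero h
  · exact hp.not_vanishesAt hg (right_ne_zero_of_mul hc.1) h

/-- Chevalley–Warning: three variables exceed the degree two, and the zero vector is already one
solution. -/
theorem exists_vanishesAt_conic {c : MvPolynomial (Fin 3) F} (hc : c.IsHomogeneous 2) :
    ∃ v : PP F, VanishesAt c v := by
  classical
  have hprime : (ringChar F).Prime := CharP.char_is_prime F _
  have hdvd := char_dvd_card_solutions (ringChar F) (f := c)
    (lt_of_le_of_lt hc.totalDegree_le (by simp))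
  have h0 : eval (0 : Fin 3 → F) c = 0 := by
    rw [← MvPolynomial.coe_aeval_eq_eval]
    exact aeval_zero_of_isHomogeneous hc two_pos
  have hcard : 1 < Fintype.card {x : Fin 3 → F // eval x c = 0} :=
    lt_of_lt_of_le hprime.one_lt (Nat.le_of_dvd (Fintype.card_pos_iff.2 ⟨⟨0, h0⟩⟩) hdvd)
  obtain ⟨⟨x, hx⟩, hne⟩ := Fintype.exists_ne_of_one_lt_card hcard ⟨0, h0⟩
  have hx0 : x ≠ 0 := fun e => hne (Subtype.ext e)
  refine ⟨Projectivization.mk F x hx0, ?_⟩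
  rw [vanishesAt_mk_iff hc]
  rw [← MvPolynomial.coe_aeval_eq_eval] at hx
  exact hx

/-- A conic through a noncollinear point of degree three has no singular rational point. -/
theorem grad_ne_zero_of_conic (hq : 2 ≤ Fintype.card F) {p : GeomPP F}
    (hp3 : (frobenius F)^[3] p = p) (hp : NotOnLine p) {c : MvPolynomial (Fin 3) F}
    (hc : IsCurve 2 c) (hcp : VanishesAt c p) {v : PP F} (hv : VanishesAt c v) :
    grad c v.rep ≠ 0 := by
  classical
  intro hgrad
  obtain ⟨l, hl, -⟩ := exists_mem_ne v v
  obtain ⟨m, hm, hml⟩ := exists_mem_ne v l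
  have hvl : v ∈ l := Projectivization.orthogonal_comm.1 hl
  have hvm : v ∈ m := Projectivization.orthogonal_comm.1 hm
  obtain ⟨y, hym, hyv⟩ := exists_mem_ne m v
  obtain ⟨z, hzl, hzv⟩ := exists_mem_ne l v
  set a := l.rep with ha
  set b := m.rep with hb
  have hya : y.rep ⬝ᵥ a ≠ 0 := fun e => hyv ((Nondegenerate.eq_or_eq
    ((mem_line_iff y l).2 e) hvl hym hvm).resolve_right hml.symm)
  have hzb : z.rep ⬝ᵥ b ≠ 0 := fun e => hzv ((Nondegenerate.eq_or_eq
    ((mem_line_iff z m).2 e) hvm hzl hvl).resolve_right hml)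
  have hyb : y.rep ⬝ᵥ b = 0 := (mem_line_iff y m).1 hym
  have hza : z.rep ⬝ᵥ a = 0 := (mem_line_iff z l).1 hzl
  have hbasis : ∀ x : Fin 3 → F, x ⬝ᵥ a = 0 → x ⬝ᵥ b = 0 → ∃ s : F, x = s • v.rep := by
    intro x hxa hxb
    rcases eq_or_ne x 0 with rfl | hx
    · exact ⟨0, by simp⟩
    · have hxv := (Nondegenerate.eq_or_eq ((mk_mem_iff hx l).2 hxa) hvl ((mk_mem_iff hx m).2 hxb)
        hvm).resolve_right hml.symm
      rw [← v.mk_rep, Projectivization.mk_eq_mk_iff'] at hxv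
      obtain ⟨s, hs⟩ := hxv
      exact ⟨s, hs.symm⟩
  -- At a singular point `v` the conic is invariant under translation by multiples of `v`, so it is
  -- a binary quadratic form in two lines `a`, `b` through `v`; `α`, `β`, `γ` below are its
  -- coefficients.
  have hcone : ∀ (x : Fin 3 → F) (s : F), aeval (x + s • v.rep) c = aeval x c := by
    intro x s
    rw [aeval_add_smul_of_quadratic hc.2, dotProduct_grad_comm hc.2, hgrad, dotProduct_zero,
      show aeval v.rep c = 0 from hv]
    ring
  set i := (y.rep ⬝ᵥ a)⁻¹ with hi
  set j := (z.rep ⬝ᵥ b)⁻¹ with hj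
  set α := i ^ 2 * aeval y.rep c with hα
  set β := i * j * (z.rep ⬝ᵥ grad c y.rep) with hβ
  set γ := j ^ 2 * aeval z.rep c with hγ
  set D : MvPolynomial (Fin 3) F := C α * linForm a ^ 2 + C β * (linForm a * linForm b)
    + C γ * linForm b ^ 2 with hD
  have hDh : D.IsHomogeneous 2 :=
    ((((linForm_isHomogeneous a).pow 2).C_mul α).add
      (((linForm_isHomogeneous a).mul (linForm_isHomogeneous b)).C_mul β)).add
      (((linForm_isHomogeneous b).pow 2).C_mul γ)
  have hcD : c = D := by
    refine IsHomogeneous.funext_of_le_card hc.2 hDh (fun x => ?_)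
      (by rw [mk_cardinal_eq]; exact_mod_cast hq)
    rw [← MvPolynomial.coe_aeval_eq_eval]
    obtain ⟨s, hs⟩ := hbasis (x - ((x ⬝ᵥ a) * i) • y.rep - ((x ⬝ᵥ b) * j) • z.rep)
      (by rw [sub_dotProduct, sub_dotProduct, smul_dotProduct, smul_dotProduct, hza, smul_zero,
            sub_zero, smul_eq_mul, hi, mul_assoc, inv_mul_cancel₀ hya, mul_one, sub_self])
      (by rw [sub_dotProduct, sub_dotProduct, smul_dotProduct, smul_dotProduct, hyb, smul_zero,
            sub_zero, smul_eq_mul, hj, mul_assoc, inv_mul_cancel₀ hzb, mul_one, sub_self])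
    have hx : x = (((x ⬝ᵥ a) * i) • y.rep + ((x ⬝ᵥ b) * j) • z.rep) + s • v.rep := by
      rw [← hs]
      abel
    have h1 : aeval x c = aeval (((x ⬝ᵥ a) * i) • y.rep + ((x ⬝ᵥ b) * j) • z.rep) c := by
      conv_lhs => rw [hx]
      exact hcone _ s
    have h2 : aeval x D = α * (x ⬝ᵥ a) ^ 2 + β * ((x ⬝ᵥ a) * (x ⬝ᵥ b)) + γ * (x ⬝ᵥ b) ^ 2 := by
      simp only [hD, map_add, map_mul, map_pow, aeval_C, aeval_linForm_self,
        Algebra.algebraMap_self, RingHom.id_apply]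
    refine h1.trans (Eq.trans ?_ h2.symm)
    rw [aeval_add_smul_of_quadratic hc.2, aeval_smul_of_isHomogeneous hc.2, grad_smul hc.2,
      dotProduct_smul, smul_eq_mul, hα, hβ, hγ]
    ring
  have hDp : VanishesAt D p := hcD ▸ hcp
  -- The ratio of `a` and `b` at `p` has degree three over `F`, so it satisfies no nontrivial
  -- quadratic equation.
  have hzero := quadratic_eq_zero_of_vanishes hp3 hp (a := a) (b := b) m.rep_nonzero (fun s e => by
    rw [e, dotProduct_smul, hyb, smul_zero] at hya
    exact hya rfl) (α := α) (β := β) (γ := γ) (by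
      have h3 : aeval p.rep D = 0 := hDp
      simp only [hD, map_add, map_mul, map_pow, aeval_C] at h3
      rw [← h3]
      ring)
  refine hc.1 ?_
  rw [hcD, hD, hzero.1, hzero.2.1, hzero.2.2]
  simp

/-- The lower bound projects from a rational point `v`: each of the `q` lines through `v` other than
the tangent there meets the conic in a second rational point. -/
theorem numPoints_conic (hq : 2 ≤ Fintype.card F) {p : GeomPP F}
    (hp3 : (frobenius F)^[3] p = p) (hp : NotOnLine p) {c : MvPolynomial (Fin 3) F}
    (hc : IsCurve 2 c) (hcp : VanishesAt c p) : numPoints c = Fintype.card F + 1 := by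
  classical
  refine le_antisymm (numPoints_le_two (hasNoLine_of_conic hp hc hcp) hc.2 hq) ?_
  obtain ⟨v, hv⟩ := exists_vanishesAt_conic hc.2
  have hg := grad_ne_zero_of_conic hq hp3 hp hc hcp hv
  set T := Projectivization.mk F _ hg with hT
  have hvC : v ∈ curvePoints c := mem_curvePoints.2 hv
  have hsec : ∀ l : PP F, v ∈ l → l ≠ T → 2 ≤ secantCount (curvePoints c) l := by
    intro l hl hlT
    obtain ⟨y, hyl, hy⟩ : ∃ y ∈ l, y.rep ⬝ᵥ grad c v.rep ≠ 0 := by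
      by_contra hcon
      push Not at hcon
      exact hlT (mk_eq_of_forall_mem hg hcon).symm
    have hyv : v ≠ y := by
      rintro rfl
      refine hy ?_
      rw [dotProduct_grad_self hc.2, show aeval v.rep c = 0 from hv, mul_zero]
    obtain ⟨x, hxc, hxl, hxv⟩ : ∃ x, VanishesAt c x ∧ x ∈ l ∧ x ≠ v := by
      by_cases hyc : VanishesAt c y
      · exact ⟨y, hyc, hyl, hyv.symm⟩
      -- The restriction to the line is `t (y ⬝ᵥ grad c v) + t² c(y)`; this is its nonzero root.
      · set t := -(y.rep ⬝ᵥ grad c v.rep) / aeval y.rep c with ht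
        have hyc' : aeval y.rep c ≠ 0 := hyc
        have ht0 : t ≠ 0 := div_ne_zero (neg_ne_zero.2 hy) hyc'
        refine ⟨Projectivization.mk F _ (rep_add_smul_ne_zero hyv t), ?_,
          mk_add_smul_mem hyv hl hyl t, ?_⟩
        · rw [vanishesAt_mk_iff hc.2, aeval_add_smul_of_quadratic hc.2,
            show aeval v.rep c = 0 from hv, ht]
          field_simp
          ring
        · intro e
          have e' := e.trans v.mk_rep.symm
          rw [Projectivization.mk_eq_mk_iff'] at e'
          obtain ⟨s, hs⟩ := e'
          refine hyv.symm ?_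
          rw [← y.mk_rep, ← v.mk_rep, Projectivization.mk_eq_mk_iff']
          refine ⟨t⁻¹ * (s - 1), ?_⟩
          rw [mul_smul, sub_smul, hs, one_smul, add_sub_cancel_left, smul_smul,
            inv_mul_cancel₀ ht0, one_smul]
    exact Finset.one_lt_card.2 ⟨x, by simp [mem_curvePoints, hxc, hxl], v,
      by simp [mem_curvePoints, hv, hl], hxv⟩
  have hsum := sum_secantCount (L := PP F) (curvePoints c) v
  rw [if_pos hvC, order_PP, ← numPoints_eq] at hsum
  have hlow : ∑ l : PP F with v ∈ l, 2 ≤ ∑ l : PP F with v ∈ l, secantCount (curvePoints c) l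
      + ∑ l : PP F with v ∈ l, (if l = T then 1 else 0) := by
    rw [← Finset.sum_add_distrib]
    refine Finset.sum_le_sum fun l hl => ?_
    have hl' : v ∈ l := by simpa using hl
    split_ifs with h
    · have := secantCount_pos hvC hl'
      omega
    · exact (hsec l hl' h).trans (Nat.le_add_right _ _)
  have hT1 : ∑ l : PP F with v ∈ l, (if l = T then 1 else 0) ≤ 1 := by
    rw [Finset.sum_ite_eq']
    split_ifs <;> omega
  rw [Finset.sum_const, card_lines_through, order_PP, smul_eq_mul] at hlow
  omega

/-- Pigeonhole: after scaling, the coordinates of `p` are fixed by the third power of Frobenius, so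
a form over `F` takes at most `q ^ 3` values there. Four monomials give `q ^ 4` forms, and the
difference of two with equal values vanishes at `p`. -/
theorem exists_conic {p : GeomPP F} (hp3 : (frobenius F)^[3] p = p) :
    ∃ c : MvPolynomial (Fin 3) F, IsCurve 2 c ∧ VanishesAt c p := by
  classical
  set K := AlgebraicClosure F
  set q := Fintype.card F with hqdef
  have hq : 1 < q := Fintype.one_lt_card
  obtain ⟨c, hc⟩ := exists_cube_frobenius_smul hp3
  obtain ⟨i, hi⟩ := Function.ne_iff.1 p.rep_nonzero
  set u : Fin 3 → K := (p.rep i)⁻¹ • p.rep with hu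
  have hc0 : c ≠ 0 := by
    rintro rfl
    have h1 := hc i
    have hq0 : q ≠ 0 := by omega
    rw [zero_mul, pow_eq_zero_iff hq0, pow_eq_zero_iff hq0, pow_eq_zero_iff hq0] at h1
    exact hi h1
  set Φ : K →ₐ[F] K := (FiniteField.frobeniusAlgHom F K).comp
    ((FiniteField.frobeniusAlgHom F K).comp (FiniteField.frobeniusAlgHom F K)) with hΦ
  have hΦapp : ∀ x, Φ x = ((x ^ q) ^ q) ^ q := fun x => rfl
  have hΦu : ∀ j, Φ (u j) = u j := fun j => by
    have h1 : u j = (p.rep i)⁻¹ * p.rep j := rfl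
    rw [h1, map_mul, map_inv₀, hΦapp, hΦapp, hc i, hc j, mul_inv, mul_mul_mul_comm,
      inv_mul_cancel₀ hc0, one_mul]
  set P : Polynomial K := Polynomial.X ^ (q ^ 3) - Polynomial.X with hP
  have hq3 : 1 < q ^ 3 := Nat.one_lt_pow (by norm_num) hq
  have hP0 : P ≠ 0 := FiniteField.X_pow_card_sub_X_ne_zero K hq3
  have hPdeg : P.natDegree = q ^ 3 := FiniteField.X_pow_card_sub_X_natDegree_eq K hq3
  have hfix : ∀ x, Φ x = x → x ∈ P.roots.toFinset := by
    intro x hx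
    rw [Multiset.mem_toFinset, Polynomial.mem_roots hP0, Polynomial.IsRoot, hP]
    rw [hΦapp, ← pow_mul, ← pow_mul] at hx
    simp only [Polynomial.eval_sub, Polynomial.eval_pow, Polynomial.eval_X, sub_eq_zero]
    rw [show q ^ 3 = q * (q * q) by ring]
    exact hx
  set form : (Fin 4 → F) → MvPolynomial (Fin 3) F := fun g =>
    C (g 0) * X 0 ^ 2 + C (g 1) * (X 0 * X 1) + C (g 2) * X 1 ^ 2 + C (g 3) * (X 0 * X 2) with hform
  have hformsub : ∀ g h, form (g - h) = form g - form h := fun g h => by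
    simp only [hform, Pi.sub_apply, C_sub]
    ring
  obtain ⟨g, -, h, -, hne, heq⟩ := Finset.exists_ne_map_eq_of_card_lt_of_maps_to
    (s := (Finset.univ : Finset (Fin 4 → F))) (t := P.roots.toFinset)
    (f := fun g => aeval u (form g))
    (by
      refine lt_of_le_of_lt ((Multiset.toFinset_card_le _).trans (Polynomial.card_roots' P)) ?_
      rw [hPdeg, Finset.card_univ, Fintype.card_fun, Fintype.card_fin]
      exact Nat.pow_lt_pow_right hq (by norm_num))
    (fun g _ => hfix _ (by
      rw [MvPolynomial.comp_aeval_apply]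
      congr 2
      funext j
      exact hΦu j))
  have hhom : ∀ g, (form g).IsHomogeneous 2 := fun g =>
    (((((isHomogeneous_X F 0).pow 2).C_mul _).add
      (((isHomogeneous_X F 0).mul (isHomogeneous_X F 1)).C_mul _)).add
      (((isHomogeneous_X F 1).pow 2).C_mul _)).add
      (((isHomogeneous_X F 0).mul (isHomogeneous_X F 2)).C_mul _)
  refine ⟨form (g - h), ⟨fun h0 => hne ?_, hhom _⟩, ?_⟩
  · have hev : ∀ x : Fin 3 → F, (g - h) 0 * x 0 ^ 2 + (g - h) 1 * (x 0 * x 1)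
        + (g - h) 2 * x 1 ^ 2 + (g - h) 3 * (x 0 * x 2) = 0 := fun x => by
      have := congrArg (aeval x) h0
      simpa [hform] using this
    -- These four evaluation points recover the four coefficients.
    have e0 := hev ![1, 0, 0]
    have e2 := hev ![0, 1, 0]
    have e1 := hev ![1, 1, 0]
    have e3 := hev ![1, 0, 1]
    simp [sub_eq_zero] at e0 e2
    simp [e0, e2, sub_eq_zero] at e1 e3
    funext j
    fin_cases j
    · exact e0
    · exact e1
    · exact e2
    · exact e3
  · have h1 : aeval u (form (g - h)) = 0 := by
      rw [hformsub, map_sub, sub_eq_zero]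
      exact heq
    rw [hu, aeval_smul_of_isHomogeneous (hhom _)] at h1
    exact (mul_eq_zero.1 h1).resolve_left (pow_ne_zero _ (inv_ne_zero hi))

end Conic

end PlaneQuintics

/-! ### The extremal quintics: a conic and three concurrent external lines -/

namespace PlaneQuintics

open MvPolynomial Configuration Configuration.ProjectivePlane Configuration.ofField

section ConicWithLines

set_option linter.unusedSectionVars false

variable {F : Type*} [Field F]

theorem linForm_smul (s : F) (a : Fin 3 → F) : linForm (s • a) = C s * linForm a := by
  simp only [linForm, Pi.smul_apply, smul_eq_mul, C_mul, Finset.mul_sum, mul_assoc]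

theorem associated_linForm_smul {s : F} (hs : s ≠ 0) (a : Fin 3 → F) :
    Associated (linForm a) (linForm (s • a)) := by
  rw [linForm_smul, mul_comm]
  exact associated_mul_unit_right _ _ ((IsUnit.mk0 s hs).map C)

theorem associated_linForm_mk_rep {a : Fin 3 → F} (ha : a ≠ 0) :
    Associated (linForm a) (linForm (Projectivization.mk F a ha).rep) := by
  obtain ⟨s, hs⟩ := Projectivization.exists_smul_eq_mk_rep F a ha
  rw [← hs, Units.smul_def]
  exact associated_linForm_smul s.ne_zero a

variable [Fintype F]

theorem eq_of_linForm_dvd {l m : PP F} (h : linForm l.rep ∣ linForm m.rep) : l = m := by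
  obtain ⟨k, hk⟩ := h
  have h1 := mk_eq_of_forall_mem (l := l) m.rep_nonzero (fun y hy => by
    rw [← mem_line_iff, ← vanishesAt_linForm_rep, hk, vanishesAt_mul, vanishesAt_linForm_rep]
    exact Or.inl hy)
  rw [← h1, m.mk_rep]

theorem exists_conicWithConcurrentLines (hq : 5 ≤ Fintype.card F) {p : GeomPP F}
    (hp3 : (frobenius F)^[3] p = p) (hp : NotOnLine p) :
    ∃ c l, IsConicWithConcurrentLines (Set.range fun n : ℕ => (frobenius F)^[n] p) c l := by
  classical
  obtain ⟨c, hc, hcp⟩ := exists_conic hp3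
  have hcard := numPoints_conic (by omega) hp3 hp hc hcp
  obtain ⟨t, ht⟩ := exists_tangentChoice hc.2
  have htc := isTangentChoice_curvePoints (hasNoLine_of_conic hp hc hcp) hc.2 two_pos (by omega) ht
  obtain ⟨R, hR⟩ := exists_three_concurrent_external (L := PP F) (by rwa [order_PP])
    (by rw [order_PP, ← numPoints_eq, hcard]) htc.secantCount_le
  obtain ⟨l₁, l₂, l₃, h₁, h₂, h₃, h₁₂, h₁₃, h₂₃⟩ := Finset.two_lt_card_iff.1 hR
  simp only [Finset.mem_filter, Finset.mem_univ, true_and] at h₁ h₂ h₃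
  set L : Fin 3 → PP F := ![l₁, l₂, l₃] with hL
  have hLinj : ∀ i j, i ≠ j → L i ≠ L j := by
    intro i j hij
    fin_cases i <;> fin_cases j <;> simp_all [Ne.symm]
  have hLR : ∀ i, R ∈ L i ∧ secantCount (curvePoints c) (L i) = 0 := by
    intro i
    fin_cases i
    · exact h₁
    · exact h₂
    · exact h₃
  refine ⟨c, fun i => linForm (L i).rep, hc, irreducible_of_conic hp hc hcp,
    (contains_orbit_iff hc.2 p).2 hcp, fun i => isCurve_linForm (L i).rep_nonzero,
    fun i j hij h => hLinj i j hij (eq_of_linForm_dvd h.dvd),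
    ⟨R, fun i => (vanishesAt_linForm_rep _ _).2 (hLR i).1⟩, ?_⟩
  rintro i S ⟨hSc, hSl⟩
  have := secantCount_pos (mem_curvePoints.2 hSc) ((vanishesAt_linForm_rep _ _).1 hSl)
  have := (hLR i).2
  omega

theorem card_three_concurrent_lines {L : Fin 3 → PP F} (hL : ∀ i j, i ≠ j → L i ≠ L j) {R : PP F}
    (hR : ∀ i, R ∈ L i) {U : Finset (PP F)} (hU : ∀ x, x ∈ U ↔ ∃ i, x ∈ L i) :
    U.card = 3 * Fintype.card F + 1 := by
  classical
  set A : Fin 3 → Finset (PP F) := fun i =>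
    (Finset.univ.filter fun x : PP F => x ∈ L i).erase R with hA
  have hAcard : ∀ i, (A i).card = Fintype.card F := fun i => by
    rw [hA, Finset.card_erase_of_mem (by simpa using hR i), card_points_on, order_PP]
    omega
  have hUeq : U = insert R (Finset.univ.biUnion A) := by
    ext x
    rw [hU, Finset.mem_insert, Finset.mem_biUnion]
    by_cases hx : x = R
    · subst hx
      simp [hR]
    · simp [hA, hx]
  rw [hUeq, Finset.card_insert_of_notMem (by simp [hA]), Finset.card_biUnion, Fin.sum_univ_three,
    hAcard, hAcard, hAcard]
  · ring
  · intro i _ j _ hij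
    rw [Function.onFun, Finset.disjoint_left]
    intro x hxi hxj
    simp only [hA, Finset.mem_erase, Finset.mem_filter, Finset.mem_univ, true_and] at hxi hxj
    exact (Nondegenerate.eq_or_eq hxi.2 (hR i) hxj.2 (hR j)).elim hxi.1 (hL i j hij)

/-- The lines contribute `3q + 1` points and the conic `q + 1` others. -/
theorem numPoints_conicWithConcurrentLines (hq : 5 ≤ Fintype.card F) {p : GeomPP F}
    (hp3 : (frobenius F)^[3] p = p) (hp : NotOnLine p) {c : MvPolynomial (Fin 3) F}
    {l : Fin 3 → MvPolynomial (Fin 3) F}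
    (h : IsConicWithConcurrentLines (Set.range fun n : ℕ => (frobenius F)^[n] p) c l) :
    c * ∏ i, l i ∈ Gamma 5 (Set.range fun n : ℕ => (frobenius F)^[n] p) ∧
      numPoints (c * ∏ i, l i) = 4 * Fintype.card F + 2 := by
  classical
  have hcp := (contains_orbit_iff h.conic.2 p).1 h.conic_contains
  have hprod : (∏ i, l i).IsHomogeneous 3 := by
    rw [Fin.prod_univ_three]
    exact ((h.line 0).2.mul (h.line 1).2).mul (h.line 2).2
  have hhom : (c * ∏ i, l i).IsHomogeneous 5 := h.conic.2.mul hprod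
  refine ⟨⟨⟨mul_ne_zero h.conic.1 (Finset.prod_ne_zero_iff.2 fun i _ => (h.line i).1), hhom⟩,
    (contains_orbit_iff hhom p).2 ((vanishesAt_mul _ _ _).2 (Or.inl hcp))⟩, ?_⟩
  have ha : ∀ i, ∃ a : Fin 3 → F, a ≠ 0 ∧ l i = linForm a := fun i => by
    obtain ⟨a, ha⟩ := exists_eq_linForm (h.line i).2
    refine ⟨a, ?_, ha⟩
    rintro rfl
    exact (h.line i).1 (by simp [ha, linForm])
  choose a ha0 hla using ha
  have hmem : ∀ i x, VanishesAt (l i) x ↔ x ∈ Projectivization.mk F (a i) (ha0 i) := fun i x => by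
    rw [hla, vanishesAt_linForm_mk (ha0 i)]
  obtain ⟨R, hR⟩ := h.concurrent
  have hU := card_three_concurrent_lines (L := fun i => Projectivization.mk F (a i) (ha0 i))
    (fun i j hij e => h.distinct i j hij (by
      rw [hla, hla]
      refine (associated_linForm_mk_rep (ha0 i)).trans ?_
      rw [e]
      exact (associated_linForm_mk_rep (ha0 j)).symm))
    (fun i => (hmem i R).1 (hR i)) (U := curvePoints (∏ i, l i)) (fun x => by
      rw [mem_curvePoints, vanishesAt_prod]
      simp [hmem])
  rw [numPoints_eq, curvePoints_mul, Finset.card_union_of_disjoint, hU, ← numPoints_eq,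
    numPoints_conic (by omega) hp3 hp h.conic hcp]
  · ring
  · rw [Finset.disjoint_left]
    intro x hxc hxl
    rw [mem_curvePoints] at hxc hxl
    obtain ⟨i, -, hi⟩ := (vanishesAt_prod _ _ _).1 hxl
    exact h.disjoint i x ⟨hxc, hi⟩

end ConicWithLines

end PlaneQuintics

/-! ### The example over the field of five elements -/

namespace PlaneQuintics

open MvPolynomial Configuration Configuration.ProjectivePlane Configuration.ofField

section Example

set_option linter.unusedSectionVars false

variable {F : Type*} [Field F] [Fintype F]

theorem five_eq_zero (h5 : Fintype.card F = 5) (K : Type*) [Field K] [Algebra F K] :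
    (5 : K) = 0 := by
  have h := FiniteField.cast_card_eq_zero F
  rw [h5] at h
  have h1 : (5 : F) = 0 := by exact_mod_cast h
  rw [← map_ofNat (algebraMap F K) 5, h1, map_zero]

/-- The point `(y² : y : 1)`. -/
def parabolaPoint {K : Type*} [Field K] (y : K) : PP K :=
  Projectivization.mk K ![y ^ 2, y, 1] (fun h => one_ne_zero (congrFun h 2))

theorem parabolaPoint_injective {K : Type*} [Field K] :
    Function.Injective (parabolaPoint (K := K)) := by
  intro y z h
  rw [parabolaPoint, parabolaPoint, Projectivization.mk_eq_mk_iff'] at h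
  obtain ⟨a, ha⟩ := h
  have h2 := congrFun ha 2
  have h1 := congrFun ha 1
  simp at h1 h2
  rw [h2, one_mul] at h1
  exact h1.symm

theorem frobenius_parabolaPoint (y : AlgebraicClosure F) :
    frobenius F (parabolaPoint y) = parabolaPoint (y ^ Fintype.card F) := by
  rw [parabolaPoint, frobenius_mk, parabolaPoint, Projectivization.mk_eq_mk_iff']
  refine ⟨1, ?_⟩
  rw [one_smul]
  ext i
  rw [frobeniusVec_apply]
  fin_cases i
  · exact pow_right_comm y _ _
  · rfl
  · exact (one_pow _).symm

theorem conic_isHomogeneous (F : Type*) [Field F] :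
    (X 0 ^ 2 + X 0 * X 2 + X 1 * X 2 : MvPolynomial (Fin 3) F).IsHomogeneous 2 ∧
    (X 0 * X 1 + X 1 * X 2 + X 2 ^ 2 : MvPolynomial (Fin 3) F).IsHomogeneous 2 ∧
    (4 * X 0 * X 2 + X 1 ^ 2 : MvPolynomial (Fin 3) F).IsHomogeneous 2 := by
  have hx : ∀ i, (X i : MvPolynomial (Fin 3) F).IsHomogeneous 1 := isHomogeneous_X F
  have h4 : (4 : MvPolynomial (Fin 3) F).IsHomogeneous 0 := isHomogeneous_C (Fin 3) (4 : F)
  exact ⟨(((hx 0).pow 2).add ((hx 0).mul (hx 2))).add ((hx 1).mul (hx 2)),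
    (((hx 0).mul (hx 1)).add ((hx 1).mul (hx 2))).add ((hx 2).pow 2),
    ((h4.mul (hx 0)).mul (hx 2)).add ((hx 1).pow 2)⟩

/-- Modulo five the third equation is `y² = xz`, which together with the first excludes `z = 0`. At
`(y² : y : 1)` the second form becomes `y³ + y + 1` and the first `y` times it. -/
theorem mem_examplePoint_iff (h5 : Fintype.card F = 5) (p : GeomPP F) :
    p ∈ examplePoint F ↔ ∃ y : AlgebraicClosure F, y ^ 3 + y + 1 = 0 ∧ p = parabolaPoint y := by
  have hK := five_eq_zero h5 (AlgebraicClosure F)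
  obtain ⟨hc1, hc2, hc3⟩ := conic_isHomogeneous F
  constructor
  · induction p using Projectivization.ind with
    | h v hv =>
      rintro ⟨e1, e2, e3⟩
      rw [vanishesAt_mk_iff hc1] at e1
      rw [vanishesAt_mk_iff hc2] at e2
      rw [vanishesAt_mk_iff hc3] at e3
      simp only [map_add, map_mul, map_pow, aeval_X, map_ofNat] at e1 e2 e3
      have hxz : v 1 ^ 2 = v 0 * v 2 := by linear_combination e3 - v 0 * v 2 * hK
      have hz : v 2 ≠ 0 := by
        intro hz
        rw [hz, mul_zero, sq_eq_zero_iff] at hxz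
        rw [hz, hxz] at e1
        have hx : v 0 = 0 := by simpa using e1
        refine hv ?_
        ext i
        fin_cases i
        · exact hx
        · exact hxz
        · exact hz
      refine ⟨v 1 / v 2, ?_, ?_⟩
      · field_simp
        linear_combination v 1 * hxz + v 2 * e2
      · rw [parabolaPoint, Projectivization.mk_eq_mk_iff']
        refine ⟨v 2, ?_⟩
        ext i
        fin_cases i
        · change v 2 * (v 1 / v 2) ^ 2 = v 0
          field_simp
          linear_combination hxz
        · change v 2 * (v 1 / v 2) = v 1
          field_simp
        · change v 2 * 1 = v 2
          rw [mul_one]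
  · rintro ⟨y, hy, rfl⟩
    refine ⟨?_, ?_, ?_⟩
    · rw [parabolaPoint, vanishesAt_mk_iff hc1]
      simp
      linear_combination y * hy
    · rw [parabolaPoint, vanishesAt_mk_iff hc2]
      simp
      linear_combination hy
    · rw [parabolaPoint, vanishesAt_mk_iff hc3]
      simp
      linear_combination y ^ 2 * hK

/-- The cubic polynomial that defines the example. -/
noncomputable def exampleCubic (F : Type*) [Field F] : Polynomial F :=
  Polynomial.X ^ 3 + Polynomial.X + 1

theorem natDegree_exampleCubic : (exampleCubic F).natDegree = 3 := by
  rw [exampleCubic]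
  compute_degree!

theorem monic_exampleCubic : (exampleCubic F).Monic := by
  rw [exampleCubic]
  monicity!

theorem irreducible_exampleCubic (h5 : Fintype.card F = 5) : Irreducible (exampleCubic F) := by
  refine Polynomial.irreducible_of_degree_le_three_of_not_isRoot ?_ ?_
  · rw [natDegree_exampleCubic]
    decide
  · intro x hx
    have hroot : x ^ 3 + x + 1 = 0 := by
      simpa [exampleCubic, Polynomial.IsRoot] using hx
    set e := (ZMod.ringEquivOfPrime F Nat.prime_five h5).symm
    have h1 := congrArg e hroot
    rw [map_add, map_add, map_pow, map_one, map_zero] at h1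
    have h2 : ∀ y : ZMod 5, y ^ 3 + y + 1 ≠ 0 := by decide
    exact h2 _ h1

theorem eq_zero_of_quadratic_relation (h5 : Fintype.card F = 5) {α : AlgebraicClosure F}
    (hα : α ^ 3 + α + 1 = 0) {a b c : F}
    (h : algebraMap F (AlgebraicClosure F) a * α ^ 2 + algebraMap F (AlgebraicClosure F) b * α
      + algebraMap F (AlgebraicClosure F) c = 0) : a = 0 ∧ b = 0 ∧ c = 0 := by
  have hmin : exampleCubic F = minpoly F α :=
    minpoly.eq_of_irreducible_of_monic (irreducible_exampleCubic h5)
      (by simpa [exampleCubic] using hα) monic_exampleCubic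
  set P : Polynomial F := Polynomial.C a * Polynomial.X ^ 2 + Polynomial.C b * Polynomial.X
    + Polynomial.C c with hP
  have hP0 : P = 0 := by
    by_contra hne
    have h1 : (minpoly F α).natDegree ≤ P.natDegree :=
      Polynomial.natDegree_le_of_dvd (minpoly.dvd F α (by simpa [hP] using h)) hne
    have h2 : P.natDegree ≤ 2 := by
      rw [hP]
      exact Polynomial.natDegree_quadratic_le
    rw [← hmin, natDegree_exampleCubic] at h1
    omega
  have e2 := congrArg (Polynomial.coeff · 2) hP0
  have e1 := congrArg (Polynomial.coeff · 1) hP0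
  have e0 := congrArg (Polynomial.coeff · 0) hP0
  simp [hP, Polynomial.coeff_X, Polynomial.coeff_C] at e0 e1 e2
  exact ⟨e2, e1, e0⟩

theorem isNoncollinearCubicPoint_examplePoint (h5 : Fintype.card F = 5) :
    IsNoncollinearCubicPoint (examplePoint F) := by
  classical
  set K := AlgebraicClosure F
  have hK : (5 : K) = 0 := five_eq_zero h5 K
  obtain ⟨α, hα'⟩ := IsAlgClosed.exists_aeval_eq_zero K (exampleCubic F)
    (Polynomial.degree_pos_of_irreducible (irreducible_exampleCubic h5)).ne'
  have hα : α ^ 3 + α + 1 = 0 := by simpa [exampleCubic] using hα'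
  -- The conjugates `α ^ 5` and `α ^ 25`, reduced modulo five and the cubic relation of `α`.
  set β : K := 1 + α - α ^ 2 with hβ
  set γ : K := α ^ 2 - 2 * α - 1 with hγ
  have hαβ : α ^ 5 = β := by linear_combination (α ^ 2 - 1) * hα
  have hβγ : β ^ 5 = γ := by
    linear_combination (-53 - 15 * α + 29 * α ^ 2 + 14 * α ^ 3 - 14 * α ^ 4 - 4 * α ^ 5
      + 5 * α ^ 6 - α ^ 7) * hα + (11 + 15 * α - 2 * α ^ 2) * hK
  have hγα : γ ^ 5 = α := by
    linear_combination (-51 + 115 * α + 65 * α ^ 2 - 54 * α ^ 3 - 31 * α ^ 4 + 34 * α ^ 5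
      - 10 * α ^ 6 + α ^ 7) * hα + (10 - 15 * α - 43 * α ^ 2) * hK
  have hrel : ∀ a b c : F, algebraMap F K a * α ^ 2 + algebraMap F K b * α
      + algebraMap F K c = 0 → c = 0 := fun a b c h => (eq_zero_of_quadratic_relation h5 hα h).2.2
  have hne1 : α ≠ β := fun e => by
    have := hrel 1 0 (-1) (by
      simp only [map_one, map_zero, map_neg]
      linear_combination e)
    exact one_ne_zero (neg_eq_zero.1 this)
  have hne2 : β ≠ γ := fun e => by
    have h1 := eq_zero_of_quadratic_relation h5 hα (a := -2) (b := 3) (c := 2) (by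
      simp only [map_neg, map_ofNat]
      linear_combination e)
    have h2 : (1 : F) = 0 := by linear_combination h1.2.1 - h1.2.2
    exact one_ne_zero h2
  have hne3 : α ≠ γ := fun e => by
    have := hrel (-1) 3 1 (by
      simp only [map_one, map_neg, map_ofNat]
      linear_combination e)
    exact one_ne_zero this
  have hβ3 : β ^ 3 + β + 1 = 0 := by
    linear_combination (-7 + α + 3 * α ^ 2 - α ^ 3) * hα + (2 + 2 * α - α ^ 2) * hK
  have hγ3 : γ ^ 3 + γ + 1 = 0 := by
    linear_combination (9 + 8 * α - 6 * α ^ 2 + α ^ 3) * hα - (2 + 5 * α + 2 * α ^ 2) * hK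
  have hroots : ∀ y : K, y ^ 3 + y + 1 = 0 → y = α ∨ y = β ∨ y = γ := by
    intro y hy
    have h1 : (y - α) * ((y - β) * (y - γ)) = 0 := by
      linear_combination hy + (y * (3 - α) - (1 + 3 * α - α ^ 2)) * hα
        + (y * (-1 - α) + (α + α ^ 2)) * hK
    rcases mul_eq_zero.1 h1 with h2 | h2
    · exact Or.inl (sub_eq_zero.1 h2)
    · rcases mul_eq_zero.1 h2 with h2 | h2
      · exact Or.inr (Or.inl (sub_eq_zero.1 h2))
      · exact Or.inr (Or.inr (sub_eq_zero.1 h2))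
  have hset : examplePoint F = {parabolaPoint α, parabolaPoint β, parabolaPoint γ} := by
    ext p
    rw [mem_examplePoint_iff h5]
    simp only [Set.mem_insert_iff, Set.mem_singleton_iff]
    constructor
    · rintro ⟨y, hy, rfl⟩
      rcases hroots y hy with rfl | rfl | rfl
      · exact Or.inl rfl
      · exact Or.inr (Or.inl rfl)
      · exact Or.inr (Or.inr rfl)
    · rintro (rfl | rfl | rfl)
      · exact ⟨α, hα, rfl⟩
      · exact ⟨β, hβ3, rfl⟩
      · exact ⟨γ, hγ3, rfl⟩
  have hφα : frobenius F (parabolaPoint α) = parabolaPoint β := by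
    rw [frobenius_parabolaPoint, h5, hαβ]
  have hφβ : frobenius F (parabolaPoint β) = parabolaPoint γ := by
    rw [frobenius_parabolaPoint, h5, hβγ]
  have hφγ : frobenius F (parabolaPoint γ) = parabolaPoint α := by
    rw [frobenius_parabolaPoint, h5, hγα]
  have horbit : examplePoint F = Set.range fun n : ℕ => (frobenius F)^[n] (parabolaPoint α) := by
    rw [hset]
    refine Set.Subset.antisymm ?_ ?_
    · rintro p (rfl | rfl | rfl)
      · exact ⟨0, rfl⟩
      · exact ⟨1, hφα⟩
      · exact ⟨2, by simp only [Function.iterate_succ, Function.iterate_zero, Function.comp_apply,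
          id_eq, hφα, hφβ]⟩
    · rintro _ ⟨n, rfl⟩
      induction n with
      | zero => exact Or.inl rfl
      | succ n ih =>
        simp only [Function.iterate_succ_apply']
        simp only [Set.mem_insert_iff, Set.mem_singleton_iff] at ih
        rcases ih with h | h | h
        · rw [h, hφα]
          exact Or.inr (Or.inl rfl)
        · rw [h, hφβ]
          exact Or.inr (Or.inr rfl)
        · rw [h, hφγ]
          exact Or.inl rfl
  refine ⟨⟨⟨_, horbit⟩, ?_⟩, ?_⟩
  · rw [hset]
    exact Set.ncard_eq_three.2 ⟨_, _, _, parabolaPoint_injective.ne hne1,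
      parabolaPoint_injective.ne hne3, parabolaPoint_injective.ne hne2, rfl⟩
  · intro l hl hcon
    obtain ⟨a, rfl⟩ := exists_eq_linForm hl.2
    have h1 := hcon (parabolaPoint α) (by rw [hset]; exact Or.inl rfl)
    rw [parabolaPoint, vanishesAt_mk_iff hl.2, aeval_linForm, Fin.sum_univ_three] at h1
    have h2 := eq_zero_of_quadratic_relation h5 hα (a := a 0) (b := a 1) (c := a 2) (by
      simpa using h1)
    refine hl.1 ?_
    simp [linForm, Fin.sum_univ_three, h2.1, h2.2.1, h2.2.2]

theorem exampleQuartic_isHomogeneous (F : Type*) [Field F] :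
    (exampleQuartic F).IsHomogeneous 4 := by
  have hx : ∀ i, (X i : MvPolynomial (Fin 3) F).IsHomogeneous 1 := isHomogeneous_X F
  have h2 : (2 : MvPolynomial (Fin 3) F).IsHomogeneous 0 := isHomogeneous_C (Fin 3) (2 : F)
  have h3 : (3 : MvPolynomial (Fin 3) F).IsHomogeneous 0 := isHomogeneous_C (Fin 3) (3 : F)
  have h4 : (4 : MvPolynomial (Fin 3) F).IsHomogeneous 0 := isHomogeneous_C (Fin 3) (4 : F)
  refine IsHomogeneous.add (IsHomogeneous.add (IsHomogeneous.add (IsHomogeneous.add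
    (IsHomogeneous.add (IsHomogeneous.add (IsHomogeneous.add (IsHomogeneous.add
    (IsHomogeneous.add (IsHomogeneous.add (IsHomogeneous.add (IsHomogeneous.add
    (IsHomogeneous.add (IsHomogeneous.add ?_ ?_) ?_) ?_) ?_) ?_) ?_) ?_) ?_) ?_) ?_) ?_) ?_) ?_) ?_
  · exact (hx 0).pow 4
  · exact (h2.mul ((hx 0).pow 3)).mul (hx 1)
  · exact (h3.mul ((hx 0).pow 3)).mul (hx 2)
  · exact (h3.mul ((hx 0).pow 2)).mul ((hx 1).pow 2)
  · exact ((h4.mul ((hx 0).pow 2)).mul (hx 1)).mul (hx 2)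
  · exact (h3.mul ((hx 0).pow 2)).mul ((hx 2).pow 2)
  · exact (h2.mul (hx 0)).mul ((hx 1).pow 3)
  · exact ((h4.mul (hx 0)).mul ((hx 1).pow 2)).mul (hx 2)
  · exact ((hx 0).mul (hx 1)).mul ((hx 2).pow 2)
  · exact (h3.mul (hx 0)).mul ((hx 2).pow 3)
  · exact h2.mul ((hx 1).pow 4)
  · exact (h4.mul ((hx 1).pow 3)).mul (hx 2)
  · exact (h2.mul ((hx 1).pow 2)).mul ((hx 2).pow 2)
  · exact (h4.mul (hx 1)).mul ((hx 2).pow 3)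
  · exact h2.mul ((hx 2).pow 4)

/-- The values of the explicit quartic. -/
def quarticValue {R : Type*} [CommRing R] (x y z : R) : R :=
  x ^ 4 + 2 * x ^ 3 * y + 3 * x ^ 3 * z + 3 * x ^ 2 * y ^ 2 + 4 * x ^ 2 * y * z
    + 3 * x ^ 2 * z ^ 2 + 2 * x * y ^ 3 + 4 * x * y ^ 2 * z + x * y * z ^ 2 + 3 * x * z ^ 3
    + 2 * y ^ 4 + 4 * y ^ 3 * z + 2 * y ^ 2 * z ^ 2 + 4 * y * z ^ 3 + 2 * z ^ 4

theorem aeval_exampleQuartic {F K : Type*} [Field F] [Field K] [Algebra F K] (v : Fin 3 → K) :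
    aeval v (exampleQuartic F) = quarticValue (v 0) (v 1) (v 2) := by
  simp only [exampleQuartic, quarticValue, map_add, map_mul, map_pow, aeval_X, map_ofNat]

theorem map_quarticValue {R S : Type*} [CommRing R] [CommRing S] (e : R ≃+* S) (x y z : R) :
    e (quarticValue x y z) = quarticValue (e x) (e y) (e z) := by
  simp only [quarticValue, map_add, map_mul, map_pow, map_ofNat]

theorem exampleQuartic_ne_zero (F : Type*) [Field F] : exampleQuartic F ≠ 0 := fun h => by
  have h1 := aeval_exampleQuartic (F := F) ![(1 : F), 0, 0]
  rw [h, map_zero] at h1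
  simp [quarticValue] at h1

theorem exampleQuartic_contains (h5 : Fintype.card F = 5) :
    Contains (exampleQuartic F) (examplePoint F) := by
  intro p hp
  obtain ⟨y, hy, rfl⟩ := (mem_examplePoint_iff h5 p).1 hp
  have hK := five_eq_zero h5 (AlgebraicClosure F)
  rw [parabolaPoint, vanishesAt_mk_iff (exampleQuartic_isHomogeneous F), aeval_exampleQuartic]
  simp only [quarticValue, Matrix.cons_val_zero, Matrix.cons_val_one, Matrix.cons_val]
  linear_combination (-3 + 2 * y + 3 * y ^ 2 + 5 * y ^ 3 + 2 * y ^ 4 + y ^ 5) * hy + (1 + y) * hK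

/-- Each projective point has `q - 1` coordinate vectors; this turns the point count into a
decidable count of vectors. -/
theorem card_nonzero_solutions {f : MvPolynomial (Fin 3) F} {d : ℕ} (hf : f.IsHomogeneous d)
    [DecidablePred fun v : Fin 3 → F => v ≠ 0 ∧ aeval v f = 0] :
    (Finset.univ.filter fun v : Fin 3 → F => v ≠ 0 ∧ aeval v f = 0).card
      = numPoints f * (Fintype.card F - 1) := by
  classical
  rw [numPoints_eq, ← Fintype.card_units, ← Finset.card_univ (α := Fˣ), ← Finset.card_product]
  symm
  refine Finset.card_bij (fun x _ => (x.2 : F) • x.1.rep) ?_ ?_ ?_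
  · rintro ⟨p, a⟩ hx
    rw [Finset.mem_product, mem_curvePoints] at hx
    simp only [Finset.mem_filter, Finset.mem_univ, true_and]
    refine ⟨smul_ne_zero a.ne_zero p.rep_nonzero, ?_⟩
    rw [aeval_smul_of_isHomogeneous hf, show aeval p.rep f = 0 from hx.1, mul_zero]
  · rintro ⟨p, a⟩ - ⟨r, b⟩ - h
    simp only at h
    have hpr : p = r := by
      rw [← p.mk_rep, ← r.mk_rep, Projectivization.mk_eq_mk_iff']
      exact ⟨(a : F)⁻¹ * b, by rw [mul_smul, ← h, smul_smul, inv_mul_cancel₀ a.ne_zero, one_smul]⟩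
    subst hpr
    have hab := smul_left_injective F p.rep_nonzero h
    rw [Units.ext hab]
  · intro v hv
    simp only [Finset.mem_filter, Finset.mem_univ, true_and] at hv
    obtain ⟨a, ha⟩ := Projectivization.exists_smul_eq_mk_rep F v hv.1
    refine ⟨(Projectivization.mk F v hv.1, a⁻¹), ?_, ?_⟩
    · rw [Finset.mem_product, mem_curvePoints, vanishesAt_mk_iff hf]
      exact ⟨hv.2, Finset.mem_univ _⟩
    · simp only
      rw [← ha, Units.smul_def, smul_smul, Units.inv_mul, one_smul]

theorem exampleQuintic_isHomogeneous (F : Type*) [Field F] :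
    (exampleQuintic F).IsHomogeneous 5 :=
  (isHomogeneous_X F 0).mul (exampleQuartic_isHomogeneous F)

/-- The number is `22 * 4`, four nonzero vectors for each projective point. -/
theorem card_quintic_zmod : (Finset.univ.filter fun v : ZMod 5 × ZMod 5 × ZMod 5 =>
    v ≠ 0 ∧ v.1 * quarticValue v.1 v.2.1 v.2.2 = 0).card = 88 := by
  decide +kernel

theorem numPoints_exampleQuintic (h5 : Fintype.card F = 5) :
    numPoints (exampleQuintic F) = 22 := by
  classical
  set e := ZMod.ringEquivOfPrime F Nat.prime_five h5
  have h1 := card_nonzero_solutions (exampleQuintic_isHomogeneous F)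
  have h2 : (Finset.univ.filter fun v : Fin 3 → F => v ≠ 0 ∧ aeval v (exampleQuintic F) = 0).card
      = 88 := by
    rw [← card_quintic_zmod]
    symm
    refine Finset.card_bij (fun v _ => ![e v.1, e v.2.1, e v.2.2]) ?_ ?_ ?_
    · rintro ⟨x, y, z⟩ hv
      simp only [Finset.mem_filter, Finset.mem_univ, true_and] at hv ⊢
      refine ⟨fun h => hv.1 ?_, ?_⟩
      · have h0 := congrFun h 0
        have h1 := congrFun h 1
        have h2 := congrFun h 2
        simp at h0 h1 h2
        rw [h0, h1, h2]
        rfl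
      · rw [exampleQuintic, map_mul, aeval_X, aeval_exampleQuartic]
        have := congrArg e hv.2
        rw [map_mul, map_quarticValue, map_zero] at this
        exact this
    · rintro ⟨x, y, z⟩ - ⟨x', y', z'⟩ - h
      have h0 := congrFun h 0
      have h1 := congrFun h 1
      have h2 := congrFun h 2
      simp at h0 h1 h2
      rw [h0, h1, h2]
    · intro v hv
      simp only [Finset.mem_filter, Finset.mem_univ, true_and] at hv
      refine ⟨(e.symm (v 0), e.symm (v 1), e.symm (v 2)), ?_, ?_⟩
      · simp only [Finset.mem_filter, Finset.mem_univ, true_and]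
        refine ⟨fun h => hv.1 ?_, ?_⟩
        · simp only [Prod.mk_eq_zero, map_eq_zero_iff _ e.symm.injective] at h
          ext i
          fin_cases i
          · exact h.1
          · exact h.2.1
          · exact h.2.2
        · have := hv.2
          rw [exampleQuintic, map_mul, aeval_X, aeval_exampleQuartic] at this
          rw [← map_quarticValue, ← map_mul, this, map_zero]
      · ext i
        fin_cases i <;> simp
  rw [h2, h5] at h1
  omega

theorem quarticValue_zero_left (h5 : Fintype.card F = 5) {y z : F}
    (h : quarticValue 0 y z = 0) : y = 0 ∧ z = 0 := by
  set e := (ZMod.ringEquivOfPrime F Nat.prime_five h5).symm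
  have h1 : ∀ y z : ZMod 5, quarticValue 0 y z = 0 → y = 0 ∧ z = 0 := by decide +kernel
  have h2 := congrArg e h
  rw [map_quarticValue, map_zero] at h2
  simpa using h1 _ _ h2

/-- A rational line would meet `x = 0` in a rational point, and the quartic has none there. -/
theorem hasNoLine_exampleQuartic (h5 : Fintype.card F = 5) : HasNoLine (exampleQuartic F) := by
  classical
  intro l hl
  obtain ⟨R, hRl, hR0⟩ : ∃ R : PP F, R ∈ l ∧ R.rep 0 = 0 := by
    have he : (Pi.single 0 1 : Fin 3 → F) ≠ 0 := by simp
    by_cases h : l = Projectivization.mk F _ he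
    · obtain ⟨R, hR, -⟩ := exists_mem_ne l l
      refine ⟨R, hR, ?_⟩
      rw [h, mem_mk_iff] at hR
      simpa using hR
    · have hax := HasPoints.mkPoint_ax (P := PP F) h
      refine ⟨_, hax.1, ?_⟩
      simpa using (mem_mk_iff he _).1 hax.2
  obtain ⟨k, hk⟩ := hl
  have hv : VanishesAt (exampleQuartic F) R := by
    rw [hk, vanishesAt_mul, vanishesAt_linForm_rep]
    exact Or.inl hRl
  rw [VanishesAt, aeval_exampleQuartic, hR0] at hv
  obtain ⟨h1, h2⟩ := quarticValue_zero_left h5 hv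
  refine R.rep_nonzero ?_
  ext i
  fin_cases i
  · exact hR0
  · exact h1
  · exact h2

theorem HasNoLine.of_dvd {f g : MvPolynomial (Fin 3) F} (hf : HasNoLine f) (h : g ∣ f) :
    HasNoLine g := fun l hl => hf l (hl.trans h)

theorem HasNoLine.not_dvd {f l : MvPolynomial (Fin 3) F} (hf : HasNoLine f)
    (hl : l.IsHomogeneous 1) (hl0 : l ≠ 0) : ¬ l ∣ f := by
  obtain ⟨a, rfl⟩ := exists_eq_linForm hl
  have ha : a ≠ 0 := by
    rintro rfl
    exact hl0 (by simp [linForm])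
  exact fun h => hf _ ((associated_linForm_mk_rep ha).symm.dvd.trans h)

/-- Linear factors being excluded, a factorization would consist of two conics without lines, with
at most `6 + 6` points; but the quartic has at least `22 - 6 = 16`, the line `x = 0` accounting for
six. -/
theorem irreducible_exampleQuartic (h5 : Fintype.card F = 5) :
    Irreducible (exampleQuartic F) := by
  classical
  have hno := hasNoLine_exampleQuartic h5
  have hcount : 16 ≤ numPoints (exampleQuartic F) := by
    have h1 := numPoints_exampleQuintic h5
    have he : (Pi.single 0 1 : Fin 3 → F) ≠ 0 := by simp
    have hX : (X 0 : MvPolynomial (Fin 3) F) = linForm (Pi.single 0 1) := by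
      simp [linForm, Fin.sum_univ_three]
    have h2 : (curvePoints (X 0 : MvPolynomial (Fin 3) F)).card = 6 := by
      have h3 := card_curvePoints_linForm (Projectivization.mk F _ he)
      rw [h5] at h3
      refine Eq.trans ?_ h3
      congr 1
      ext x
      rw [mem_curvePoints, mem_curvePoints, hX, vanishesAt_linForm_mk he, vanishesAt_linForm_rep]
    rw [numPoints_eq, exampleQuintic, curvePoints_mul] at h1
    have h4 := Finset.card_union_le (curvePoints (X 0 : MvPolynomial (Fin 3) F))
      (curvePoints (exampleQuartic F))
    rw [numPoints_eq]
    omega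
  refine irreducible_of_forall_ne_mul (exampleQuartic_isHomogeneous F) (exampleQuartic_ne_zero F)
    (by norm_num) ?_
  intro m n A B hm hn hmn hA hB hAB
  have hA0 : A ≠ 0 := by
    rintro rfl
    exact exampleQuartic_ne_zero F (by simpa using hAB)
  have hB0 : B ≠ 0 := by
    rintro rfl
    exact exampleQuartic_ne_zero F (by simpa using hAB)
  have hAd : A ∣ exampleQuartic F := ⟨B, hAB⟩
  have hBd : B ∣ exampleQuartic F := ⟨A, by rw [hAB, mul_comm]⟩
  have hm1 : m ≠ 1 := by
    rintro rfl
    exact hno.not_dvd hA hA0 hAd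
  have hn1 : n ≠ 1 := by
    rintro rfl
    exact hno.not_dvd hB hB0 hBd
  obtain rfl : m = 2 := by omega
  obtain rfl : n = 2 := by omega
  have h6 := numPoints_le_two (hno.of_dvd hAd) hA (by omega)
  have h7 := numPoints_le_two (hno.of_dvd hBd) hB (by omega)
  rw [hAB, numPoints_eq, curvePoints_mul] at hcount
  have h8 := Finset.card_union_le (curvePoints A) (curvePoints B)
  rw [← numPoints_eq, ← numPoints_eq] at h8
  omega

end Example

end PlaneQuintics

/-! ### The theorem -/

theorem mainTheorem12 {F : Type*} [Field F] [Fintype F] (q : ℕ) (hcard : Fintype.card F = q)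
    (hq : 5 ≤ q) :
    (∀ P : Set (PlaneQuintics.GeomPP F), PlaneQuintics.IsNoncollinearCubicPoint P →
      (∀ f ∈ PlaneQuintics.Gamma 5 P, PlaneQuintics.numPoints f ≤ 4 * q + 2) ∧
      (∃ f ∈ PlaneQuintics.Gamma 5 P, PlaneQuintics.numPoints f = 4 * q + 2) ∧
      (∀ c l, PlaneQuintics.IsConicWithConcurrentLines P c l →
        c * ∏ i, l i ∈ PlaneQuintics.Gamma 5 P ∧
        PlaneQuintics.numPoints (c * ∏ i, l i) = 4 * q + 2) ∧
      (7 ≤ q → ∃ c l, PlaneQuintics.IsConicWithConcurrentLines P c l)) ∧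
    (q = 5 →
      PlaneQuintics.IsNoncollinearCubicPoint (PlaneQuintics.examplePoint F) ∧
      Irreducible (PlaneQuintics.exampleQuartic F) ∧
      PlaneQuintics.exampleQuartic F ∈ PlaneQuintics.Gamma 4 (PlaneQuintics.examplePoint F) ∧
      PlaneQuintics.exampleQuintic F ∈ PlaneQuintics.Gamma 5 (PlaneQuintics.examplePoint F) ∧
      PlaneQuintics.numPoints (PlaneQuintics.exampleQuintic F) = 22) := by
  subst hcard
  refine ⟨fun P hP => ?_, fun h5 => ?_⟩
  · obtain ⟨p, rfl, hp3, hp⟩ := hP.exists_point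
    obtain ⟨c, l, hcl⟩ := PlaneQuintics.exists_conicWithConcurrentLines hq hp3 hp
    refine ⟨fun f hf => ?_, ?_, fun c l h =>
      PlaneQuintics.numPoints_conicWithConcurrentLines hq hp3 hp h, fun _ => ⟨c, l, hcl⟩⟩
    · exact PlaneQuintics.numPoints_le_of_vanishesAt hq hp 4 le_rfl f hf.1.1 hf.1.2
        ((PlaneQuintics.contains_orbit_iff hf.1.2 p).1 hf.2)
    · exact ⟨_, PlaneQuintics.numPoints_conicWithConcurrentLines hq hp3 hp hcl⟩
  · have hcon := PlaneQuintics.exampleQuartic_contains h5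
    refine ⟨PlaneQuintics.isNoncollinearCubicPoint_examplePoint h5,
      PlaneQuintics.irreducible_exampleQuartic h5,
      ⟨⟨PlaneQuintics.exampleQuartic_ne_zero F, PlaneQuintics.exampleQuartic_isHomogeneous F⟩,
        hcon⟩,
      ⟨⟨mul_ne_zero (MvPolynomial.X_ne_zero 0) (PlaneQuintics.exampleQuartic_ne_zero F),
        PlaneQuintics.exampleQuintic_isHomogeneous F⟩,
        fun p hp => (PlaneQuintics.vanishesAt_mul _ _ _).2 (Or.inr (hcon p hp))⟩,
      PlaneQuintics.numPoints_exampleQuintic h5⟩
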